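/- For $p\in\mathbb{R}^n$ and $r\ge 0$ let $C(p,r)=\{x\in\mathbb{R}^n : \|x-p\|_1\le r\}$ be the cross-polytope ($L_1$-ball) with centre $p$ and radius $r$. For $\Pi=(p_1,\dots,p_k)$ with $p_i\in\mathbb{R}^n$ and $\mathbf r=(r_1,\dots,r_k)$ with $r_i\ge 0$, put $S(\Pi,\mathbf r)=\bigcap_{i=1}^k C(p_i,r_i)$. **Theorem.** There is a deterministic algorithm (a program on a real random access machine with exact arithmetic $+,-,\times,/$ and comparisons on reals, integer counters and indices with $+,-,\times$ and comparisons, unit cost per elementary operation, and no rounding operation) which, given integers $k,n\ge 1$, centres $p_1,\dots,p_k\in\mathbb{R}^n$, radii $r_1,\dots,r_k\ge 0$ such that every $p_i$ is an interior point of $S(\Pi,\mathbf r)$, and $0<\delta\le 1$, outputs a number $Z$ with $$\mathrm{Vol}(S(\Pi,\mathbf r))\ \le\ Z\ \le\ (1+\delta)\,\mathrm{Vol}(S(\Pi,\mathbf r)).$$ For every constant $k$ its running time is $O\!\left(k^{k+2}n^{2k+3}/\delta^{k+1}\right)$, where the hidden constant depends on $k$ only and is at most $C^{k+1}$ for an absolute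 constant $C$. In particular this holds under the normalization $p_1=0$ and $0\le r_i\le 1$ for all $i$. -/

import Mathlib

/-! ## Cross-polytopes -/

/-- The cross-polytope with centre `c` and radius `r` in `ℝⁿ`, i.e. the closed `L₁`-ball. -/
def crossPolytope {n : ℕ} (c : Fin n → ℝ) (r : ℝ) : Set (Fin n → ℝ) :=
  {x | ∑ j, |x j - c j| ≤ r}

/-- The intersection of the `k` cross-polytopes with centres `p i` and radii `r i`. -/
def crossInter {k n : ℕ} (p : Fin k → Fin n → ℝ) (r : Fin k → ℝ) : Set (Fin n → ℝ) :=
  ⋂ i, crossPolytope (p i) (r i)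

/-! ## A real random access machine

Programs are written in a small imperative language over finitely many arrays of natural numbers
(used as counters and indices) and finitely many arrays of real numbers.  The arithmetic is exact,
every elementary operation costs one unit of time, and there is no rounding operation and no real
constant other than the natural numbers. -/

namespace RealRAM

/-- The memory: `nat a i` is cell `i` of the integer array `a`, and `real a i` is cell `i` of the
real array `a`.  An array used as a plain variable is one of which only cell `0` is used. -/
structure Memory where
  nat : ℕ → ℕ → ℕ
  real : ℕ → ℕ → ℝ

/-- Integer expressions: constants, array cells at a computed index, and arithmetic
(with truncated subtraction). -/
inductive NExp where
  | const (c : ℕ)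
  | cell (a : ℕ) (i : NExp)
  | add (e f : NExp)
  | sub (e f : NExp)
  | mul (e f : NExp)

/-- Real expressions: values of integer expressions, array cells at a computed index, and the
four arithmetic operations. -/
inductive RExp where
  | ofNat (e : NExp)
  | cell (a : ℕ) (i : NExp)
  | add (e f : RExp)
  | sub (e f : RExp)
  | mul (e f : RExp)
  | div (e f : RExp)

/-- Tests: comparisons of integers and of reals, and Boolean combinations of them. -/
inductive Test where
  | natLe (e f : NExp)
  | realLe (e f : RExp)
  | not (b : Test)
  | and (b c : Test)

/-- Programs. -/
inductive Prog where
  | skip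
  | setNat (a : ℕ) (i : NExp) (e : NExp)
  | setReal (a : ℕ) (i : NExp) (e : RExp)
  | seq (P Q : Prog)
  | ite (b : Test) (P Q : Prog)
  | loop (b : Test) (P : Prog)

/-- The value of an integer expression. -/
def NExp.eval (s : Memory) : NExp → ℕ
  | .const c => c
  | .cell a i => s.nat a (i.eval s)
  | .add e f => e.eval s + f.eval s
  | .sub e f => e.eval s - f.eval s
  | .mul e f => e.eval s * f.eval s

/-- The value of a real expression. -/
noncomputable def RExp.eval (s : Memory) : RExp → ℝ
  | .ofNat e => (e.eval s : ℝ)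
  | .cell a i => s.real a (i.eval s)
  | .add e f => e.eval s + f.eval s
  | .sub e f => e.eval s - f.eval s
  | .mul e f => e.eval s * f.eval s
  | .div e f => e.eval s / f.eval s

/-- The truth value of a test. -/
def Test.holds (s : Memory) : Test → Prop
  | .natLe e f => e.eval s ≤ f.eval s
  | .realLe e f => e.eval s ≤ f.eval s
  | .not b => ¬ b.holds s
  | .and b c => b.holds s ∧ c.holds s

/-- The time to evaluate an integer expression: one unit per constant, memory access and
arithmetic operation. -/
def NExp.cost : NExp → ℕ
  | .const _ => 1
  | .cell _ i => i.cost + 1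
  | .add e f => e.cost + f.cost + 1
  | .sub e f => e.cost + f.cost + 1
  | .mul e f => e.cost + f.cost + 1

/-- The time to evaluate a real expression. -/
def RExp.cost : RExp → ℕ
  | .ofNat e => e.cost + 1
  | .cell _ i => i.cost + 1
  | .add e f => e.cost + f.cost + 1
  | .sub e f => e.cost + f.cost + 1
  | .mul e f => e.cost + f.cost + 1
  | .div e f => e.cost + f.cost + 1

/-- The time to evaluate a test. -/
def Test.cost : Test → ℕ
  | .natLe e f => e.cost + f.cost + 1
  | .realLe e f => e.cost + f.cost + 1
  | .not b => b.cost + 1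
  | .and b c => b.cost + c.cost + 1

/-- Overwrite one integer cell. -/
def Memory.writeNat (s : Memory) (a i v : ℕ) : Memory :=
  { s with nat := Function.update s.nat a (Function.update (s.nat a) i v) }

/-- Overwrite one real cell. -/
noncomputable def Memory.writeReal (s : Memory) (a i : ℕ) (v : ℝ) : Memory :=
  { s with real := Function.update s.real a (Function.update (s.real a) i v) }

/-- `Exec P s t s'`: started on the memory `s`, the program `P` halts after exactly `t` units of
time, leaving the memory `s'`. -/
inductive Exec : Prog → Memory → ℕ → Memory → Prop where
  | skip (s : Memory) : Exec .skip s 1 s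
  | setNat (a : ℕ) (i e : NExp) (s : Memory) :
      Exec (.setNat a i e) s (i.cost + e.cost + 1) (s.writeNat a (i.eval s) (e.eval s))
  | setReal (a : ℕ) (i : NExp) (e : RExp) (s : Memory) :
      Exec (.setReal a i e) s (i.cost + e.cost + 1) (s.writeReal a (i.eval s) (e.eval s))
  | seq {P Q : Prog} {s s' s'' : Memory} {t t' : ℕ} :
      Exec P s t s' → Exec Q s' t' s'' → Exec (.seq P Q) s (t + t') s''
  | iteTrue {b : Test} {P Q : Prog} {s s' : Memory} {t : ℕ} :
      b.holds s → Exec P s t s' → Exec (.ite b P Q) s (b.cost + 1 + t) s'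
  | iteFalse {b : Test} {P Q : Prog} {s s' : Memory} {t : ℕ} :
      ¬ b.holds s → Exec Q s t s' → Exec (.ite b P Q) s (b.cost + 1 + t) s'
  | loopDone {b : Test} {P : Prog} {s : Memory} :
      ¬ b.holds s → Exec (.loop b P) s (b.cost + 1) s
  | loopStep {b : Test} {P : Prog} {s s' s'' : Memory} {t t' : ℕ} :
      b.holds s → Exec P s t s' → Exec (.loop b P) s' t' s'' →
      Exec (.loop b P) s (b.cost + 1 + t + t') s''

/-- Execution is deterministic, so that a halting program has one output and one running time. -/
theorem Exec.deterministic {P : Prog} {s s₁ s₂ : Memory} {t₁ t₂ : ℕ}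
    (h₁ : Exec P s t₁ s₁) (h₂ : Exec P s t₂ s₂) : t₁ = t₂ ∧ s₁ = s₂ := by
  induction h₁ generalizing t₂ s₂ with
  | skip s => cases h₂; exact ⟨rfl, rfl⟩
  | setNat a i e s => cases h₂; exact ⟨rfl, rfl⟩
  | setReal a i e s => cases h₂; exact ⟨rfl, rfl⟩
  | seq _ _ ih ih' =>
    cases h₂ with
    | seq k k' =>
      obtain ⟨rfl, rfl⟩ := ih k
      obtain ⟨rfl, rfl⟩ := ih' k'
      exact ⟨rfl, rfl⟩
  | iteTrue hb _ ih =>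
    cases h₂ with
    | iteTrue _ k => obtain ⟨rfl, rfl⟩ := ih k; exact ⟨rfl, rfl⟩
    | iteFalse hb' _ => exact absurd hb hb'
  | iteFalse hb _ ih =>
    cases h₂ with
    | iteTrue hb' _ => exact absurd hb' hb
    | iteFalse _ k => obtain ⟨rfl, rfl⟩ := ih k; exact ⟨rfl, rfl⟩
  | loopDone hb =>
    cases h₂ with
    | loopDone _ => exact ⟨rfl, rfl⟩
    | loopStep hb' _ _ => exact absurd hb' hb
  | loopStep hb _ _ ih ih' =>
    cases h₂ with
    | loopDone hb' => exact absurd hb hb'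
    | loopStep _ k k' =>
      obtain ⟨rfl, rfl⟩ := ih k
      obtain ⟨rfl, rfl⟩ := ih' k'
      exact ⟨rfl, rfl⟩

/-- The input memory.  The integer array `0` holds `n, k`; the real array `0` holds `δ`; the real
array `1` holds the radii; the real array `2` holds the centres one after the other, the
coordinate `p i j` in cell `i * n + j`.  All other cells are `0`. -/
noncomputable def input {k n : ℕ} (p : Fin k → Fin n → ℝ) (r : Fin k → ℝ) (δ : ℝ) : Memory where
  nat a i := if a = 0 ∧ i = 0 then n else if a = 0 ∧ i = 1 then k else 0
  real a i :=
    if a = 0 ∧ i = 0 then δ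
    else if a = 1 then (if h : i < k then r ⟨i, h⟩ else 0)
    else if a = 2 then
      (if h : i < k * n then p (Fin.divNat ⟨i, h⟩) (Fin.modNat ⟨i, h⟩) else 0)
    else 0

/-- The output is read off cell `0` of the real array `3`. -/
def Memory.output (s : Memory) : ℝ := s.real 3 0

end RealRAM

/-! The volume is approximated by counting grid cells, and the cells are counted by dynamic
programming over vectors of rounded distances.

Let `r m` be the smallest radius, `h = r m / M`, and cut the cube of half-side `r m` around `p m`
into cells of width `h`. For each cell, centre and coordinate, the distance is rounded down to an
integer multiple of `h` that bounds it from below on the whole cell. Cells whose rounded distances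
sum to at most `r i` for every `i` cover the intersection `S`, so their total volume is at least
that of `S`. Conversely, rounding loses at most `3 * h` per coordinate, so these cells lie in the
intersection with all radii enlarged by `3 * n * h`. Since every centre lies in `S`, the centroid of
the centres satisfies each constraint with slack `r i / k`; hence the enlarged body lies in the
image of `S` under a homothety about the centroid with ratio `1 + 3 * n * k / M`
(`crossInter_add_subset_homothety`). With `M = 6 * k * n ^ 2 * D` and `D` about `1 / δ`, the `n`-th
power of this ratio is at most `1 + δ` (`volume_crossInter_approx`, `one_add_div_pow_le`).

Because the centres also lie within `r m` of `p m`, all relevant sums are at most `2 * M`, however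
large the other radii are. So a vector of `k` partial sums fits in one integer with `k` digits in
base `B = 4 * M + 2`, and a table with `B ^ k` entries per coordinate suffices (`dpCount_succ_eq`).
Filling it takes time of order `n * k * B ^ (k + 1)`, which is the claimed bound because `B` is of
order `k * n ^ 2 / δ` (`time_le`). -/

namespace RealRAM

/-! ### Frames, and a program logic with time bounds -/

/-- The integer arrays that a program may write. -/
def Prog.natWrites : Prog → List ℕ
  | .skip => []
  | .setNat a _ _ => [a]
  | .setReal _ _ _ => []
  | .seq P Q => P.natWrites ++ Q.natWrites
  | .ite _ P Q => P.natWrites ++ Q.natWrites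
  | .loop _ P => P.natWrites

/-- The real arrays that a program may write. -/
def Prog.realWrites : Prog → List ℕ
  | .skip => []
  | .setNat _ _ _ => []
  | .setReal a _ _ => [a]
  | .seq P Q => P.realWrites ++ Q.realWrites
  | .ite _ P Q => P.realWrites ++ Q.realWrites
  | .loop _ P => P.realWrites

/-- The memories `s` and `s'` agree on all arrays that `P` does not write. -/
structure Agree (P : Prog) (s s' : Memory) : Prop where
  nat : ∀ a, a ∉ P.natWrites → s'.nat a = s.nat a
  real : ∀ a, a ∉ P.realWrites → s'.real a = s.real a

@[simp] theorem writeNat_nat (s : Memory) (a i v b j : ℕ) :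
    (s.writeNat a i v).nat b j = if b = a ∧ j = i then v else s.nat b j := by
  by_cases h : b = a
  · subst h; by_cases hj : j = i <;> simp [Memory.writeNat, Function.update, hj]
  · simp [Memory.writeNat, Function.update, h]

@[simp] theorem writeNat_real (s : Memory) (a i v : ℕ) :
    (s.writeNat a i v).real = s.real := rfl

@[simp] theorem writeReal_nat (s : Memory) (a i : ℕ) (v : ℝ) :
    (s.writeReal a i v).nat = s.nat := rfl

@[simp] theorem writeReal_real (s : Memory) (a i : ℕ) (v : ℝ) (b j : ℕ) :
    (s.writeReal a i v).real b j = if b = a ∧ j = i then v else s.real b j := by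
  by_cases h : b = a
  · subst h; by_cases hj : j = i <;> simp [Memory.writeReal, Function.update, hj]
  · simp [Memory.writeReal, Function.update, h]

theorem writeNat_nat_of_ne (s : Memory) {a b : ℕ} (i v : ℕ) (h : b ≠ a) :
    (s.writeNat a i v).nat b = s.nat b := by
  simp [Memory.writeNat, Function.update, h]

theorem writeReal_real_of_ne (s : Memory) {a b : ℕ} (i : ℕ) (v : ℝ) (h : b ≠ a) :
    (s.writeReal a i v).real b = s.real b := by
  simp [Memory.writeReal, Function.update, h]

/-- The write sets are syntactic, so in the specifications below the preservation of a variable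
reduces to a decidable list membership. -/
theorem Exec.agree {P : Prog} {s s' : Memory} {t : ℕ} (h : Exec P s t s') : Agree P s s' := by
  induction h with
  | skip s => exact ⟨fun _ _ => rfl, fun _ _ => rfl⟩
  | setNat a i e s =>
    exact ⟨fun b hb => writeNat_nat_of_ne s _ _ (by simpa [Prog.natWrites] using hb),
      fun _ _ => rfl⟩
  | setReal a i e s =>
    exact ⟨fun _ _ => rfl,
      fun b hb => writeReal_real_of_ne s _ _ (by simpa [Prog.realWrites] using hb)⟩
  | seq _ _ ih ih' =>
    constructor
    · intro a ha
      simp only [Prog.natWrites, List.mem_append, not_or] at ha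
      rw [ih'.nat a ha.2, ih.nat a ha.1]
    · intro a ha
      simp only [Prog.realWrites, List.mem_append, not_or] at ha
      rw [ih'.real a ha.2, ih.real a ha.1]
  | iteTrue _ _ ih =>
    constructor
    · intro a ha
      simp only [Prog.natWrites, List.mem_append, not_or] at ha
      exact ih.nat a ha.1
    · intro a ha
      simp only [Prog.realWrites, List.mem_append, not_or] at ha
      exact ih.real a ha.1
  | iteFalse _ _ ih =>
    constructor
    · intro a ha
      simp only [Prog.natWrites, List.mem_append, not_or] at ha
      exact ih.nat a ha.2
    · intro a ha
      simp only [Prog.realWrites, List.mem_append, not_or] at ha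
      exact ih.real a ha.2
  | loopDone _ => exact ⟨fun _ _ => rfl, fun _ _ => rfl⟩
  | loopStep _ _ _ ih ih' =>
    constructor
    · intro a ha
      rw [ih'.nat a ha, ih.nat a ha]
    · intro a ha
      rw [ih'.real a ha, ih.real a ha]

/-- Started on `s`, the program `P` halts within time `T` in a memory satisfying `Q`. -/
def Runs (P : Prog) (s : Memory) (T : ℕ) (Q : Memory → Prop) : Prop :=
  ∃ t s', Exec P s t s' ∧ t ≤ T ∧ Q s'

theorem Runs.mono {P : Prog} {s : Memory} {T T' : ℕ} {Q Q' : Memory → Prop}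
    (h : Runs P s T Q) (hT : T ≤ T') (hQ : ∀ s', Agree P s s' → Q s' → Q' s') :
    Runs P s T' Q' := by
  obtain ⟨t, s', he, ht, hq⟩ := h
  exact ⟨t, s', he, ht.trans hT, hQ s' he.agree hq⟩

theorem Runs.skip {s : Memory} {T : ℕ} {Q : Memory → Prop} (h : Q s) (hT : 1 ≤ T) :
    Runs .skip s T Q := ⟨_, _, .skip s, hT, h⟩

theorem Runs.setNat {a : ℕ} {i e : NExp} {s : Memory} {T : ℕ} {Q : Memory → Prop}
    (h : Q (s.writeNat a (i.eval s) (e.eval s))) (hT : i.cost + e.cost + 1 ≤ T) :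
    Runs (.setNat a i e) s T Q := ⟨_, _, .setNat a i e s, hT, h⟩

theorem Runs.setReal {a : ℕ} {i : NExp} {e : RExp} {s : Memory} {T : ℕ} {Q : Memory → Prop}
    (h : Q (s.writeReal a (i.eval s) (e.eval s))) (hT : i.cost + e.cost + 1 ≤ T) :
    Runs (.setReal a i e) s T Q := ⟨_, _, .setReal a i e s, hT, h⟩

/-- The second program receives the frame of the first besides its postcondition, so postconditions
need only mention what has changed. -/
theorem Runs.seq {P P' : Prog} {s : Memory} {T T' : ℕ} {Q Q' : Memory → Prop}
    (h : Runs P s T Q) (h' : ∀ s', Agree P s s' → Q s' → Runs P' s' T' Q') :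
    Runs (.seq P P') s (T + T') Q' := by
  obtain ⟨t, s', he, ht, hq⟩ := h
  obtain ⟨t', s'', he', ht', hq'⟩ := h' s' he.agree hq
  exact ⟨_, _, he.seq he', Nat.add_le_add ht ht', hq'⟩

theorem Runs.ite {b : Test} {P P' : Prog} {s : Memory} {T : ℕ} {Q : Memory → Prop}
    (h : b.holds s → Runs P s T Q) (h' : ¬ b.holds s → Runs P' s T Q) :
    Runs (.ite b P P') s (b.cost + 1 + T) Q := by
  by_cases hb : b.holds s
  · obtain ⟨t, s', he, ht, hq⟩ := h hb
    exact ⟨_, _, .iteTrue hb he, Nat.add_le_add_left ht _, hq⟩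
  · obtain ⟨t, s', he, ht, hq⟩ := h' hb
    exact ⟨_, _, .iteFalse hb he, Nat.add_le_add_left ht _, hq⟩

/-- The integer variable held in cell `0` of array `a`. -/
abbrev NExp.var (a : ℕ) : NExp := .cell a (.const 0)

/-- Assignment to an integer variable. -/
abbrev Prog.assign (a : ℕ) (e : NExp) : Prog := .setNat a (.const 0) e

/-- Assignment to a real variable. -/
abbrev Prog.assignReal (a : ℕ) (e : RExp) : Prog := .setReal a (.const 0) e

/-- `for v = 0, …, b - 1 do P`. -/
def Prog.for (v : ℕ) (b : NExp) (P : Prog) : Prog :=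
  .seq (.assign v (.const 0))
    (.loop (.not (.natLe b (.var v))) (.seq P (.assign v (.add (.var v) (.const 1)))))

/-- The invariant rule for counting loops. -/
theorem Runs.for {v : ℕ} {b : NExp} {P : Prog} {s : Memory} {N T : ℕ}
    (I : ℕ → Memory → Prop)
    (hv : v ∉ P.natWrites)
    (hb : ∀ s', Agree (.for v b P) s s' → b.eval s' = N)
    (h0 : I 0 (s.writeNat v 0 0))
    (hstep : ∀ i < N, ∀ s', Agree (.for v b P) s s' → s'.nat v 0 = i → I i s' →
      Runs P s' T fun s'' => I (i + 1) (s''.writeNat v 0 (i + 1))) :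
    Runs (.for v b P) s ((N + 1) * (T + b.cost + 11)) (I N) := by
  -- Induction on the number `d` of remaining iterations; the `b.cost + 5` is the price of the
  -- final, failing test.
  have key : ∀ d i : ℕ, i + d = N → ∀ s', Agree (.for v b P) s s' → s'.nat v 0 = i → I i s' →
      Runs (.loop (.not (.natLe b (.var v))) (.seq P (.assign v (.add (.var v) (.const 1)))))
        s' (d * (T + b.cost + 11) + (b.cost + 5)) (I N) := by
    intro d
    induction d with
    | zero =>
      intro i hi s' hA hvi hI
      obtain rfl : i = N := by omega
      refine ⟨_, _, .loopDone ?_, ?_, hI⟩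
      · simp [Test.holds, NExp.eval, hb s' hA, hvi]
      · simp [Test.cost, NExp.cost]
    | succ d ih =>
      intro i hi s' hA hvi hI
      obtain ⟨t, s'', he, ht, hq⟩ := hstep i (by omega) s' hA hvi hI
      have hs'' : s''.nat v 0 = i := by rw [he.agree.nat v hv, hvi]
      have hset := Exec.setNat v (.const 0) (.add (.var v) (.const 1)) s''
      simp only [NExp.eval, NExp.cost, hs''] at hset
      have hbody := he.seq hset
      have hA' : Agree (.for v b P) s (s''.writeNat v 0 (i + 1)) := by
        constructor
        · intro a ha
          rw [← hA.nat a ha]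
          exact hbody.agree.nat a (by
            simp only [Prog.for, Prog.natWrites, List.mem_append, not_or] at ha ⊢
            exact ha.2)
        · intro a ha
          rw [← hA.real a ha]
          exact hbody.agree.real a (by
            simp only [Prog.for, Prog.realWrites, List.mem_append, not_or] at ha ⊢
            exact ha.2)
      obtain ⟨t', s₃, he', ht', hq'⟩ := ih (i + 1) (by omega) _ hA' (by simp) hq
      refine ⟨_, _, .loopStep ?_ hbody he', ?_, hq'⟩
      · simp only [Test.holds, NExp.eval, hb s' hA, hvi]; omega
      · simp only [Test.cost, NExp.cost, Nat.add_mul, one_mul]; omega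
  have hset := Exec.setNat v (.const 0) (.const 0) s
  simp only [NExp.eval, NExp.cost] at hset
  have hA : Agree (.for v b P) s (s.writeNat v 0 0) := by
    constructor
    · intro a ha
      exact hset.agree.nat a (by
        simp only [Prog.for, Prog.natWrites, List.mem_append, not_or] at ha ⊢
        exact ha.1)
    · intro a ha
      rfl
  obtain ⟨t, s', he, ht, hq⟩ := key N 0 (by omega) _ hA (by simp) h0
  refine ⟨_, _, hset.seq he, ?_, hq⟩
  rw [Nat.add_mul, one_mul]; omega

end RealRAM

/-! ### Geometry of intersections of cross-polytopes -/

open MeasureTheory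

theorem mem_crossInter {k n : ℕ} {p : Fin k → Fin n → ℝ} {r : Fin k → ℝ} {x : Fin n → ℝ} :
    x ∈ crossInter p r ↔ ∀ i, ∑ j, |x j - p i j| ≤ r i := by
  simp [crossInter, crossPolytope]

/-- A ball around `p i` contains the point with every coordinate shifted by `ε / 2`, and that point
has positive distance from `p i`. -/
theorem radius_pos_of_mem_interior {k n : ℕ} (hn : 1 ≤ n) {p : Fin k → Fin n → ℝ}
    {r : Fin k → ℝ} {i : Fin k} (h : p i ∈ interior (crossInter p r)) : 0 < r i := by
  obtain ⟨ε, hε, hb⟩ := Metric.mem_nhds_iff.1 (mem_interior_iff_mem_nhds.1 h)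
  have hx : (fun j => p i j + ε / 2) ∈ Metric.ball (p i) ε := by
    rw [Metric.mem_ball, dist_pi_lt_iff hε]
    intro j
    simp [abs_of_pos hε]
    linarith
  have h1 := mem_crossInter.1 (hb hx) i
  simp only [add_sub_cancel_left, Finset.sum_const, Finset.card_univ, Fintype.card_fin,
    nsmul_eq_mul] at h1
  have h2 : (0 : ℝ) < n := by exact_mod_cast hn
  have h3 : 0 < |ε / 2| := abs_pos.2 (by positivity)
  exact (mul_pos h2 h3).trans_le h1

/-- In the average of the vectors `p l - p i` the term `l = i` vanishes and each other term has norm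
at most `r i`. The factor `k - 1` instead of `k` is the slack on which the volume comparison rests.
-/
theorem card_mul_sum_abs_centroid_sub_le {k n : ℕ} (hk : 1 ≤ k) {p : Fin k → Fin n → ℝ}
    {r : Fin k → ℝ} (hd : ∀ i l, ∑ j, |p l j - p i j| ≤ r i) (i : Fin k) :
    (k : ℝ) * ∑ j, |(∑ l, p l j) / k - p i j| ≤ (k - 1) * r i := by
  have hk0 : (0 : ℝ) < k := by exact_mod_cast hk
  calc (k : ℝ) * ∑ j, |(∑ l, p l j) / k - p i j|
      = ∑ j, |∑ l, (p l j - p i j)| := by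
        rw [Finset.mul_sum]
        refine Finset.sum_congr rfl fun j _ => ?_
        have : ∑ l, (p l j - p i j) = k * ((∑ l, p l j) / k - p i j) := by
          rw [Finset.sum_sub_distrib]
          simp only [Finset.sum_const, Finset.card_univ, Fintype.card_fin, nsmul_eq_mul]
          field_simp
        rw [this, abs_mul, abs_of_pos hk0]
    _ ≤ ∑ j, ∑ l, |p l j - p i j| :=
        Finset.sum_le_sum fun j _ => Finset.abs_sum_le_sum_abs _ _
    _ = ∑ l, ∑ j, |p l j - p i j| := Finset.sum_comm
    _ = ∑ l ∈ Finset.univ.erase i, ∑ j, |p l j - p i j| := by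
        rw [← Finset.add_sum_erase _ _ (Finset.mem_univ i)]
        simp
    _ ≤ ∑ l ∈ Finset.univ.erase i, r i := Finset.sum_le_sum fun l _ => hd i l
    _ = (k - 1) * r i := by
        simp [Finset.card_erase_of_mem, Nat.cast_sub hk]

/-- If `y` is the preimage of `x` and `c` the centroid, then `(1 + α) * (y - p i) = (x - p i) + α *
(c - p i)`. The slack `α * r i / k` gained from the centroid absorbs the enlargement `e`. -/
theorem crossInter_add_subset_homothety {k n : ℕ} (hk : 1 ≤ k) {p : Fin k → Fin n → ℝ}
    {r : Fin k → ℝ} (hd : ∀ i l, ∑ j, |p l j - p i j| ≤ r i) {α e : ℝ} (hα : 0 ≤ α)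
    (he : ∀ i, k * e ≤ α * r i) :
    crossInter p (fun i => r i + e) ⊆
      AffineMap.homothety (fun j => (∑ l, p l j) / (k : ℝ)) (1 + α) '' crossInter p r := by
  intro x hx
  have hk0 : (0 : ℝ) < k := by exact_mod_cast hk
  have hα1 : 0 < 1 + α := by linarith
  set c : Fin n → ℝ := fun j => (∑ l, p l j) / (k : ℝ) with hc
  refine ⟨fun j => c j + (x j - c j) / (1 + α), ?_, ?_⟩
  · rw [mem_crossInter] at hx ⊢
    intro i
    have h1 := card_mul_sum_abs_centroid_sub_le hk hd i
    have h2 := hx i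
    have h3 : (1 + α) * ∑ j, |c j + (x j - c j) / (1 + α) - p i j| ≤
        ∑ j, |x j - p i j| + α * ∑ j, |c j - p i j| := by
      rw [Finset.mul_sum, Finset.mul_sum, ← Finset.sum_add_distrib]
      refine Finset.sum_le_sum fun j _ => ?_
      calc (1 + α) * |c j + (x j - c j) / (1 + α) - p i j|
          = |(1 + α) * (c j + (x j - c j) / (1 + α) - p i j)| := by
            rw [abs_mul, abs_of_pos hα1]
        _ = |(x j - p i j) + α * (c j - p i j)| := by
            congr 1; field_simp; ring
        _ ≤ |x j - p i j| + |α * (c j - p i j)| := abs_add_le _ _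
        _ = |x j - p i j| + α * |c j - p i j| := by rw [abs_mul, abs_of_nonneg hα]
    have h4 := mul_le_mul_of_nonneg_left h1 hα
    have h5 := mul_le_mul_of_nonneg_left h2 hk0.le
    have h6 := mul_le_mul_of_nonneg_left h3 hk0.le
    have h7 := he i
    refine le_of_mul_le_mul_left ?_ (mul_pos hk0 hα1)
    linarith
  · ext j
    simp only [AffineMap.homothety_apply, vsub_eq_sub, vadd_eq_add, Pi.add_apply, Pi.smul_apply,
      Pi.sub_apply, smul_eq_mul]
    field_simp
    ring

/-! ### Rounding to a grid, and comparison of the cell count with the volume. -/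

/-- The lower bound, in units of `h`, for the distance to `q` on the interval `[y, y + h)`. -/
noncomputable def cellDist (h q y : ℝ) : ℕ := ⌊|y - q| / h⌋₊ - 1

/-- The subtracted unit pays for moving from the corner `y` to `x`; if the truncated subtraction
gives `0`, the bound is trivial. -/
theorem cellDist_mul_le {h q y x : ℝ} (hh : 0 < h) (h1 : y ≤ x) (h2 : x ≤ y + h) :
    cellDist h q y * h ≤ |x - q| := by
  unfold cellDist
  rcases Nat.eq_zero_or_pos ⌊|y - q| / h⌋₊ with h0 | h0
  · simp [h0]
  · rw [Nat.cast_sub h0, sub_mul]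
    have h3 : (⌊|y - q| / h⌋₊ : ℝ) * h ≤ |y - q| :=
      (le_div_iff₀ hh).1 (Nat.floor_le (by positivity))
    have h4 : |y - q| ≤ |y - x| + |x - q| := abs_sub_le _ _ _
    have h5 : |y - x| ≤ h := by rw [abs_le]; constructor <;> linarith
    push_cast
    linarith

/-- The three units are the floor, the subtracted unit, and the move from `y` to `x`. -/
theorem le_cellDist_add_mul {h q y x : ℝ} (hh : 0 < h) (h1 : y ≤ x) (h2 : x ≤ y + h) :
    |x - q| ≤ (cellDist h q y + 3) * h := by
  have h3 : |y - q| < (⌊|y - q| / h⌋₊ + 1) * h := (div_lt_iff₀ hh).1 (Nat.lt_floor_add_one _)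
  have h4 : |x - q| ≤ |x - y| + |y - q| := abs_sub_le _ _ _
  have h5 : |x - y| ≤ h := by rw [abs_le]; constructor <;> linarith
  have h6 : (⌊|y - q| / h⌋₊ : ℝ) ≤ cellDist h q y + 1 := by
    unfold cellDist
    have h8 : ∀ a : ℕ, a ≤ a - 1 + 1 := fun a => by omega
    exact_mod_cast h8 _
  have h7 := mul_le_mul_of_nonneg_right h6 hh.le
  linarith

/-- A cell of the grid of width `h` whose coordinate hyperplanes are `b j + a * h`. -/
def gridCell {n L : ℕ} (h : ℝ) (b : Fin n → ℝ) (a : Fin n → Fin L) : Set (Fin n → ℝ) :=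
  Set.univ.pi fun j => Set.Ico (b j + (a j : ℕ) * h) (b j + (a j : ℕ) * h + h)

theorem volume_real_biUnion_gridCell {n L : ℕ} {h : ℝ} (hh : 0 < h) (b : Fin n → ℝ)
    (A : Finset (Fin n → Fin L)) :
    volume (⋃ a ∈ A, gridCell h b a) ≠ ⊤ ∧
      volume.real (⋃ a ∈ A, gridCell h b a) = A.card * h ^ n := by
  have hv : ∀ a : Fin n → Fin L, volume (gridCell h b a) = ENNReal.ofReal h ^ n := by
    intro a
    rw [gridCell, Real.volume_pi_Ico]
    simp
  have hd : Set.PairwiseDisjoint (A : Set (Fin n → Fin L)) (gridCell h b) := by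
    intro a _ a' _ haa
    refine Set.disjoint_left.2 fun x hx hx' => haa ?_
    ext j
    have h1 := hx j (Set.mem_univ j)
    have h2 := hx' j (Set.mem_univ j)
    simp only [Set.mem_Ico] at h1 h2
    have h3 : ((a j : ℕ) : ℝ) < (a' j : ℕ) + 1 := by
      refine lt_of_mul_lt_mul_right ?_ hh.le; linarith
    have h4 : ((a' j : ℕ) : ℝ) < (a j : ℕ) + 1 := by
      refine lt_of_mul_lt_mul_right ?_ hh.le; linarith
    have h5 : (a j : ℕ) < a' j + 1 := by exact_mod_cast h3
    have h6 : (a' j : ℕ) < a j + 1 := by exact_mod_cast h4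
    omega
  have hm : ∀ a ∈ A, MeasurableSet (gridCell h b a) := fun a _ =>
    MeasurableSet.univ_pi fun j => measurableSet_Ico
  have hU : volume (⋃ a ∈ A, gridCell h b a) = A.card * ENNReal.ofReal h ^ n := by
    rw [measure_biUnion_finset hd hm]
    simp [hv]
  refine ⟨?_, ?_⟩
  · rw [hU]; finiteness
  · rw [Measure.real, hU]
    simp [hh.le]

open Classical in
/-- The cells whose rounded distances meet the constraints. -/
noncomputable def goodCells {k n : ℕ} (M : ℕ) (h : ℝ) (r : Fin k → ℝ)
    (c : Fin k → Fin n → ℕ → ℕ) : Finset (Fin n → Fin (2 * M + 1)) :=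
  Finset.univ.filter fun a => ∀ i, ∑ j, c i j (a j) ≤ 2 * M ∧
    ((∑ j, c i j (a j) : ℕ) : ℝ) * h ≤ r i

theorem volume_crossInter_approx {k n : ℕ} (hk : 1 ≤ k) {p : Fin k → Fin n → ℝ}
    {r : Fin k → ℝ} (hd : ∀ i l, ∑ j, |p l j - p i j| ≤ r i) (m : Fin k)
    (hm : ∀ i, r m ≤ r i) (hr : 0 < r m) {M : ℕ} (hM : 1 ≤ M) {h : ℝ} (hh : h = r m / M) :
    let A := goodCells M h r fun i j a => cellDist h (p i j) (p m j - M * h + a * h)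
    volume.real (crossInter p r) ≤ A.card * h ^ n ∧
      A.card * h ^ n ≤ (1 + 3 * n * k / M) ^ n * volume.real (crossInter p r) := by
  intro A
  have hM0 : (0 : ℝ) < M := by exact_mod_cast hM
  have hh0 : 0 < h := by rw [hh]; positivity
  have hMh : M * h = r m := by rw [hh]; field_simp
  obtain ⟨hfin, hvol⟩ := volume_real_biUnion_gridCell hh0 (fun j => p m j - M * h) A
  have hsub : crossInter p r ⊆ ⋃ a ∈ A, gridCell h (fun j => p m j - M * h) a := by
    intro x hx
    rw [mem_crossInter] at hx
    have hxm : ∀ j, |x j - p m j| ≤ M * h := fun j =>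
      (Finset.single_le_sum (f := fun j => |x j - p m j|) (fun _ _ => abs_nonneg _)
        (Finset.mem_univ j)).trans ((hx m).trans_eq hMh.symm)
    have hnn : ∀ j, 0 ≤ (x j - (p m j - M * h)) / h := fun j =>
      div_nonneg (by have := (abs_le.1 (hxm j)).1; linarith) hh0.le
    -- The value `2 * M` occurs at the right end of the closed cube, whence `2 * M + 1` half-open
    -- cells per coordinate.
    have hlt : ∀ j, ⌊(x j - (p m j - M * h)) / h⌋₊ < 2 * M + 1 := by
      intro j
      rw [Nat.lt_succ_iff]
      refine Nat.floor_le_of_le ?_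
      rw [div_le_iff₀ hh0]
      have := (abs_le.1 (hxm j)).2
      push_cast
      linarith
    set a : Fin n → Fin (2 * M + 1) := fun j => ⟨_, hlt j⟩ with ha
    have hlo : ∀ j, p m j - M * h + (a j : ℕ) * h ≤ x j := fun j => by
      have := (le_div_iff₀ hh0).1 (Nat.floor_le (hnn j))
      simp only [ha]
      linarith
    have hhi : ∀ j, x j < p m j - M * h + (a j : ℕ) * h + h := fun j => by
      have := (div_lt_iff₀ hh0).1 (Nat.lt_floor_add_one ((x j - (p m j - M * h)) / h))
      simp only [ha]
      linarith
    have hsum : ∀ i, ((∑ j, cellDist h (p i j) (p m j - M * h + (a j : ℕ) * h) : ℕ) : ℝ) * h ≤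
        ∑ j, |x j - p i j| := by
      intro i
      rw [Nat.cast_sum, Finset.sum_mul]
      exact Finset.sum_le_sum fun j _ => cellDist_mul_le hh0 (hlo j) (hhi j).le
    refine Set.mem_biUnion (x := a) ?_ fun j _ => ⟨hlo j, hhi j⟩
    simp only [A, goodCells, Finset.coe_filter, Finset.mem_univ, true_and, Set.mem_ofPred_eq]
    intro i
    refine ⟨?_, (hsum i).trans (hx i)⟩
    -- The cap `2 * M` excludes no cell that meets `S`: both `x` and `p i` are within `r m = M * h`
    -- of `p m`.
    have h1 : ∑ j, |x j - p i j| ≤ 2 * M * h := by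
      have h2 : ∑ j, |x j - p i j| ≤ ∑ j, |x j - p m j| + ∑ j, |p i j - p m j| := by
        rw [← Finset.sum_add_distrib]
        refine Finset.sum_le_sum fun j _ => ?_
        rw [abs_sub_comm (p i j)]
        exact abs_sub_le _ _ _
      have h3 := hx m
      have h4 := hd m i
      linarith
    have h2 := le_of_mul_le_mul_right ((hsum i).trans h1) hh0
    exact_mod_cast h2
  have hsub' : (⋃ a ∈ A, gridCell h (fun j => p m j - M * h) a) ⊆
      AffineMap.homothety (fun j => (∑ l, p l j) / (k : ℝ)) (1 + 3 * n * k / (M : ℝ)) ''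
        crossInter p r := by
    -- With `e = 3 * n * h` the required slack is `k * e = (3 * n * k / M) * r m`, and `r m` is the
    -- smallest radius.
    refine Set.Subset.trans ?_ (crossInter_add_subset_homothety hk hd (e := 3 * n * h)
      (by positivity) ?_)
    · refine Set.iUnion₂_subset fun a haA x hx => ?_
      rw [mem_crossInter]
      intro i
      simp only [A, goodCells, Finset.mem_filter, Finset.mem_univ, true_and] at haA
      have h1 := (haA i).2
      rw [Nat.cast_sum, Finset.sum_mul] at h1
      have h2 : ∑ j, |x j - p i j| ≤
          ∑ j, ((cellDist h (p i j) (p m j - M * h + (a j : ℕ) * h) : ℝ) * h + 3 * h) := by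
        refine Finset.sum_le_sum fun j _ => ?_
        have hj := hx j (Set.mem_univ j)
        rw [← add_mul]
        exact le_cellDist_add_mul hh0 hj.1 hj.2.le
      rw [Finset.sum_add_distrib] at h2
      simp only [Finset.sum_const, Finset.card_univ, Fintype.card_fin, nsmul_eq_mul] at h2
      linarith
    · intro i
      have h1 : (k : ℝ) * (3 * n * h) = 3 * n * k / M * r m := by
        rw [hh]; ring
      rw [h1]
      exact mul_le_mul_of_nonneg_left (hm i) (by positivity)
  have hfinS : volume (crossInter p r) ≠ ⊤ := measure_ne_top_of_subset hsub hfin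
  have himg := Measure.addHaar_image_homothety (volume : Measure (Fin n → ℝ))
    (fun j => (∑ l, p l j) / (k : ℝ)) (1 + 3 * n * k / (M : ℝ)) (crossInter p r)
  have hpow : 0 ≤ (1 + 3 * n * k / (M : ℝ)) ^ n := by positivity
  rw [Module.finrank_fin_fun, abs_of_nonneg hpow] at himg
  rw [← hvol]
  refine ⟨measureReal_mono hsub hfin, ?_⟩
  refine (measureReal_mono hsub' ?_).trans_eq ?_
  · rw [himg]; finiteness
  · rw [Measure.real, himg, ENNReal.toReal_mul, ENNReal.toReal_ofReal hpow, Measure.real]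

/-- With `x = 1 / (2 * D)`, the power is at most `exp x ≤ 1 + x + x ^ 2 ≤ 1 + 2 * x = 1 + 1 / D`. -/
theorem one_add_div_pow_le {n D : ℕ} (hn : 1 ≤ n) {δ : ℝ} (hD : 1 ≤ D) (hδ : 1 ≤ D * δ) :
    (1 + 1 / (2 * n * D : ℝ)) ^ n ≤ 1 + δ := by
  have hn0 : (0 : ℝ) < n := by exact_mod_cast hn
  have hD0 : (1 : ℝ) ≤ D := by exact_mod_cast hD
  set x : ℝ := 1 / (2 * D) with hx
  have hx0 : 0 < x := by positivity
  have hx1 : x ≤ 1 := by rw [hx, div_le_one (by positivity)]; linarith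
  have h1 : (1 + 1 / (2 * n * D : ℝ)) ^ n ≤ Real.exp x := by
    have h2 : (1 + 1 / (2 * n * D : ℝ)) ≤ Real.exp (x / n) := by
      refine le_trans (le_of_eq ?_) (Real.add_one_le_exp _)
      rw [hx]; field_simp; ring
    refine (pow_le_pow_left₀ (by positivity) h2 n).trans_eq ?_
    rw [← Real.exp_nat_mul]; congr 1; field_simp
  have h3 := (abs_le.1 (Real.abs_exp_sub_one_sub_id_le (x := x) (by rwa [abs_of_pos hx0]))).2
  have h4 : x ^ 2 ≤ x := by nlinarith
  have h5 : 2 * x ≤ δ := by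
    rw [hx]
    have : 2 * (1 / (2 * (D : ℝ))) = 1 / D := by field_simp
    rw [this, div_le_iff₀ (by linarith)]
    linarith
  linarith

/-! ### Counting by dynamic programming over encoded vectors -/

open Classical in
/-- The number of sequences `a 0, …, a (j - 1)` below `L` for which the sums `w i + ∑ l, c i l (a l)`
meet the constraints `ok i`, `i < k`. -/
noncomputable def dpCount (k L : ℕ) (ok : ℕ → ℕ → Prop) (c : ℕ → ℕ → ℕ → ℕ) :
    ℕ → (ℕ → ℕ) → ℕ
  | 0, w => if ∀ i < k, ok i (w i) then 1 else 0
  | j + 1, w => ∑ a ∈ Finset.range L, dpCount k L ok c j fun i => w i + c i j a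

open Classical in
theorem dpCount_eq_card (k L : ℕ) (ok : ℕ → ℕ → Prop) (c : ℕ → ℕ → ℕ → ℕ) (n : ℕ) (w : ℕ → ℕ) :
    dpCount k L ok c n w = (Finset.univ.filter fun a : Fin n → Fin L =>
      ∀ i < k, ok i (w i + ∑ j : Fin n, c i j (a j))).card := by
  induction n generalizing w with
  | zero =>
    rw [dpCount, Finset.card_filter, Fintype.sum_unique]
    simp
  | succ n ih =>
    rw [dpCount, Finset.card_filter,
      ← Fintype.sum_equiv (Fin.snocEquiv fun _ => Fin L) _ _ (fun _ => rfl),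
      Fintype.sum_prod_type, Finset.sum_range]
    refine Finset.sum_congr rfl fun x _ => ?_
    rw [ih, Finset.card_filter]
    refine Finset.sum_congr rfl fun a _ => ?_
    have h : ∀ i, w i + c i n x + ∑ j : Fin n, c i j (a j) = w i + ∑ j : Fin (n + 1), c i j
        ((Fin.snocEquiv (fun _ : Fin (n + 1) => Fin L) (x, a)) j) := by
      intro i
      rw [Fin.sum_univ_castSucc]
      simp [Fin.snocEquiv]
      ring
    simp only [h]

/-- Sums only grow and `ok` is downward closed, so a violated constraint is never repaired. -/
theorem dpCount_eq_zero {k L : ℕ} {ok : ℕ → ℕ → Prop} {c : ℕ → ℕ → ℕ → ℕ}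
    (hok : ∀ i d e, ok i (d + e) → ok i d) (j : ℕ) {w : ℕ → ℕ} (hw : ¬ ∀ i < k, ok i (w i)) :
    dpCount k L ok c j w = 0 := by
  induction j generalizing w with
  | zero => simp only [dpCount, if_neg hw]
  | succ j ih =>
    rw [dpCount]
    refine Finset.sum_eq_zero fun a _ => ih fun h => hw fun i hi => hok _ _ _ (h i hi)

/-- The number with base-`B` digits `w 0, …, w (k - 1)`. -/
def encode (B k : ℕ) (w : ℕ → ℕ) : ℕ := ∑ i ∈ Finset.range k, w i * B ^ i

theorem encode_succ (B k : ℕ) (w : ℕ → ℕ) :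
    encode B (k + 1) w = encode B k w + w k * B ^ k := Finset.sum_range_succ _ _

theorem encode_add (B k : ℕ) (w c : ℕ → ℕ) :
    encode B k w + encode B k c = encode B k fun i => w i + c i := by
  simp only [encode, ← Finset.sum_add_distrib, add_mul]

theorem encode_lt {B k : ℕ} {w : ℕ → ℕ} (hw : ∀ i < k, w i < B) : encode B k w < B ^ k := by
  induction k with
  | zero => simp [encode]
  | succ k ih =>
    rw [encode_succ, pow_succ]
    have h1 := ih fun i hi => hw i (by omega)
    have h2 := Nat.mul_le_mul_right (B ^ k) (Nat.succ_le_of_lt (hw k (by omega)))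
    rw [Nat.succ_mul] at h2
    rw [mul_comm (B ^ k)]
    omega

open Classical in
/-- Whether the first `i` base-`B` digits of `x` satisfy `ok`. -/
noncomputable def validCode (B : ℕ) (ok : ℕ → ℕ → Prop) : ℕ → ℕ → ℕ
  | 0, _ => 1
  | i + 1, x => if ok i (x / B ^ i) then validCode B ok i (x % B ^ i) else 0

theorem validCode_succ_of_lt {B i x : ℕ} {ok : ℕ → ℕ → Prop} (hx : x < B ^ i) (h0 : ok i 0) :
    validCode B ok (i + 1) x = validCode B ok i x := by
  rw [validCode, Nat.div_eq_of_lt hx, Nat.mod_eq_of_lt hx, if_pos h0]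

open Classical in
theorem validCode_succ_mul_add {B i d V : ℕ} (ok : ℕ → ℕ → Prop) (hV : V < B ^ i) :
    validCode B ok (i + 1) (d * B ^ i + V) = if ok i d then validCode B ok i V else 0 := by
  have h1 : (d * B ^ i + V) / B ^ i = d := by
    rw [mul_comm, Nat.mul_add_div (by omega), Nat.div_eq_of_lt hV, add_zero]
  have h2 : (d * B ^ i + V) % B ^ i = V := by
    rw [mul_comm, Nat.mul_add_mod, Nat.mod_eq_of_lt hV]
  rw [validCode, h1, h2]

theorem validCode_encode {B k L : ℕ} {w : ℕ → ℕ} (ok : ℕ → ℕ → Prop) (c : ℕ → ℕ → ℕ → ℕ)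
    (hw : ∀ i < k, w i < B) : validCode B ok k (encode B k w) = dpCount k L ok c 0 w := by
  induction k with
  | zero => simp [validCode, dpCount]
  | succ k ih =>
    have hw' : ∀ i < k, w i < B := fun i hi => hw i (by omega)
    rw [encode_succ, add_comm (encode B k w), validCode_succ_mul_add ok (encode_lt hw'), ih hw']
    have h : (∀ i < k + 1, ok i (w i)) ↔ ok k (w k) ∧ ∀ i < k, ok i (w i) := by
      rw [Nat.forall_lt_succ_right, and_comm]
    simp only [dpCount]
    split_ifs <;> first | rfl | (exfalso; tauto)

/-- For admissible `w`, no carry occurs when a distance vector is added, so adding codes adds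
vectors. Otherwise the factor `F₀` is `0`; the sum may then read meaningless table entries without
harm. -/
theorem dpCount_succ_eq {k L B j : ℕ} {ok : ℕ → ℕ → Prop} {c : ℕ → ℕ → ℕ → ℕ}
    (hok : ∀ i d e, ok i (d + e) → ok i d) (hB : ∀ i d a, ok i d → d + c i j a < B)
    {F₀ F : ℕ → ℕ}
    (h0 : ∀ w : ℕ → ℕ, (∀ i < k, w i < B) → F₀ (encode B k w) = dpCount k L ok c 0 w)
    (hF : ∀ w : ℕ → ℕ, (∀ i < k, w i < B) → F (encode B k w) = dpCount k L ok c j w)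
    {w : ℕ → ℕ} (hw : ∀ i < k, w i < B) :
    F₀ (encode B k w) *
      ∑ a ∈ Finset.range L, F (encode B k w + encode B k fun i => c i j a) =
    dpCount k L ok c (j + 1) w := by
  rw [h0 w hw]
  by_cases h : ∀ i < k, ok i (w i)
  · rw [dpCount, if_pos h, one_mul, dpCount]
    refine Finset.sum_congr rfl fun a _ => ?_
    rw [encode_add]
    exact hF _ fun i hi => hB i _ a (h i hi)
  · rw [dpCount_eq_zero hok _ h, dpCount_eq_zero hok _ h, zero_mul]

namespace RealRAM

/-! ### The program

Integer arrays: `1` inverse precision, `2` half the number of grid steps, `3` index of the smallest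
radius, `4` size of a table layer, `5` the table, `6` encoded distance vectors, `7` accumulator,
`8` power of the base, `14` the base; the others are loop counters.  Real arrays: `4` grid width. -/

/-- The dimension. -/
abbrev dimE : NExp := .cell 0 (.const 0)

/-- The number of cross-polytopes. -/
abbrev numE : NExp := .cell 0 (.const 1)

/-- The grid width. -/
abbrev widthE : RExp := .cell 4 (.const 0)

/-- Corner of grid cell `a` minus centre `i`, in coordinate `j`. -/
def diffE : RExp :=
  .sub (.add (.sub (.cell 2 (.add (.mul (.var 3) dimE) (.var 12))) (.mul (.ofNat (.var 2)) widthE))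
    (.mul (.ofNat (.var 13)) widthE)) (.cell 2 (.add (.mul (.var 9) dimE) (.var 12)))

/-- Whether the distance is at least `q + 2` grid steps. -/
def distTest : Test :=
  .not (.and
    (.not (.realLe (.mul (.ofNat (.add (.var 15) (.const 2))) widthE) diffE))
    (.not (.realLe (.mul (.ofNat (.add (.var 15) (.const 2))) widthE)
      (.sub (.ofNat (.const 0)) diffE))))

/-- Computes a rounded distance. -/
def distProg : Prog :=
  .seq (.assign 7 (.const 0))
    (.for 15 (.mul (.const 2) (.var 2))
      (.ite distTest (.assign 7 (.add (.var 7) (.const 1))) .skip))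

/-- The rounded distance computed by `distProg`. -/
noncomputable def roundedDist (M : ℕ) (h : ℝ) (p : ℕ → ℕ → ℝ) (m i j a : ℕ) : ℕ :=
  min (2 * M) (cellDist h (p i j) (p m j - M * h + a * h))

/-- There is no rounding operation, so the floor is found by counting the `q < 2 * M` with `(q + 2)
* h ≤ |d|`. The offset `2` accounts for the subtracted unit in `cellDist` and for counting from `0`.
-/
theorem distProg_spec {s : Memory} {M n m i j a : ℕ} {h : ℝ} (hh : 0 < h)
    (h2 : s.nat 2 0 = M) (h0 : s.nat 0 0 = n) (h3 : s.nat 3 0 = m) (h9 : s.nat 9 0 = i)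
    (h12 : s.nat 12 0 = j) (h13 : s.nat 13 0 = a) (h4 : s.real 4 0 = h) :
    Runs distProg s (200 * (2 * M + 1)) fun s' =>
      s'.nat 7 0 = roundedDist M h (fun i j => s.real 2 (i * n + j)) m i j a := by
  set d := s.real 2 (m * n + j) - M * h + a * h - s.real 2 (i * n + j) with hd
  refine Runs.mono (Runs.seq (Q := fun s' => s'.nat 7 0 = 0)
    (Runs.setNat (by simp [NExp.eval]) le_rfl) fun s₁ hA₁ hz =>
    Runs.for (N := 2 * M) (T := 100)
      (fun q s' => s'.nat 7 0 = min q (⌊|d| / h⌋₊ - 1)) (by decide) ?_ ?_ ?_)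
    (T' := 200 * (2 * M + 1)) ?_ ?_
  · intro s' hA
    simp [NExp.eval, hA.nat 2 (by decide), hA₁.nat 2 (by decide), h2]
  · simp [hz]
  · intro q hq s' hA hv hI
    have e2 : s'.nat 2 = s.nat 2 := by rw [hA.nat 2 (by decide), hA₁.nat 2 (by decide)]
    have e0 : s'.nat 0 = s.nat 0 := by rw [hA.nat 0 (by decide), hA₁.nat 0 (by decide)]
    have e3 : s'.nat 3 = s.nat 3 := by rw [hA.nat 3 (by decide), hA₁.nat 3 (by decide)]
    have e9 : s'.nat 9 = s.nat 9 := by rw [hA.nat 9 (by decide), hA₁.nat 9 (by decide)]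
    have e12 : s'.nat 12 = s.nat 12 := by rw [hA.nat 12 (by decide), hA₁.nat 12 (by decide)]
    have e13 : s'.nat 13 = s.nat 13 := by rw [hA.nat 13 (by decide), hA₁.nat 13 (by decide)]
    have er2 : s'.real 2 = s.real 2 := by rw [hA.real 2 (by decide), hA₁.real 2 (by decide)]
    have er4 : s'.real 4 = s.real 4 := by rw [hA.real 4 (by decide), hA₁.real 4 (by decide)]
    have hdiff : diffE.eval s' = d := by
      simp [diffE, RExp.eval, NExp.eval, e2, e0, e3, e9, e12, e13, er2, er4, h2, h0, h3, h9, h12,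
        h13, h4, hd]
    have htest : distTest.holds s' ↔ q + 2 ≤ ⌊|d| / h⌋₊ := by
      rw [Nat.le_floor_iff (by positivity), le_div_iff₀ hh, le_abs]
      simp only [distTest, Test.holds, RExp.eval, NExp.eval, hdiff, hv, er4, h4]
      push_cast
      rw [zero_sub]
      tauto
    refine Runs.mono (Runs.ite (T := 6) (fun ht => Runs.setNat ?_ ?_) fun ht => Runs.skip ?_ ?_)
      ?_ fun _ _ hq => hq
    · rw [htest] at ht
      simp [NExp.eval, hI]
      omega
    · simp [NExp.cost]
    · rw [htest] at ht
      simp [hI]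
      omega
    · norm_num
    · simp [distTest, diffE, Test.cost, RExp.cost, NExp.cost]
  · simp [NExp.cost]
    omega
  · intro s' _ hI
    rw [hI, roundedDist, cellDist]

/-- Computes the encoded vector of rounded distances of one grid cell. -/
def keyProg : Prog :=
  .seq (.setNat 6 (.var 13) (.const 0)) (.seq (.assign 8 (.const 1))
    (.for 9 numE (.seq distProg (.seq
      (.setNat 6 (.var 13) (.add (.cell 6 (.var 13)) (.mul (.var 7) (.var 8))))
      (.assign 8 (.mul (.var 8) (.var 14)))))))

theorem keyProg_spec {s : Memory} {M n k m j a B : ℕ} {h : ℝ} (hh : 0 < h) (hk : 1 ≤ k)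
    (h2 : s.nat 2 0 = M) (h0 : s.nat 0 0 = n) (h01 : s.nat 0 1 = k) (h3 : s.nat 3 0 = m)
    (h12 : s.nat 12 0 = j) (h13 : s.nat 13 0 = a) (h14 : s.nat 14 0 = B) (h4 : s.real 4 0 = h) :
    Runs keyProg s (1000 * k * (2 * M + 1)) fun s' =>
      s'.nat 6 a = encode B k
        (fun i => roundedDist M h (fun i j => s.real 2 (i * n + j)) m i j a) ∧
      ∀ x, x ≠ a → s'.nat 6 x = s.nat 6 x := by
  set c : ℕ → ℕ := fun i => roundedDist M h (fun i j => s.real 2 (i * n + j)) m i j a with hc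
  refine Runs.mono (Runs.seq (Q := fun s' => s'.nat 6 a = 0 ∧ ∀ x, x ≠ a → s'.nat 6 x = s.nat 6 x)
    (Runs.setNat (by simp +contextual [NExp.eval, h13]) le_rfl) fun s₁ hA₁ hz₁ => Runs.seq
    (Q := fun s' => s'.nat 8 0 = 1) (Runs.setNat (by simp [NExp.eval]) le_rfl) fun s₂ hA₂ hz₂ =>
    Runs.for (N := k) (T := 200 * (2 * M + 1) + (20 + 20))
      (fun i s' => s'.nat 6 a = encode B i c ∧ s'.nat 8 0 = B ^ i ∧
        ∀ x, x ≠ a → s'.nat 6 x = s.nat 6 x) (by decide) ?_ ?_ ?_)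
      (T' := 1000 * k * (2 * M + 1)) ?_ ?_
  · intro s' hA
    simp [NExp.eval, hA.nat 0 (by decide), hA₂.nat 0 (by decide), hA₁.nat 0 (by decide), h01]
  · simp [hz₂, hA₂.nat 6 (by decide), hz₁.1, encode]
    exact hz₁.2
  · intro i hi s' hA hv hI
    have e : ∀ b, b = 0 ∨ b = 2 ∨ b = 3 ∨ b = 12 ∨ b = 13 ∨ b = 14 → s'.nat b = s.nat b := by
      rintro b (rfl | rfl | rfl | rfl | rfl | rfl) <;>
      rw [hA.nat _ (by decide), hA₂.nat _ (by decide), hA₁.nat _ (by decide)]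
    have er : ∀ b, s'.real b = s.real b := fun b => by
      rw [hA.real b (by simp [Prog.realWrites, Prog.for, distProg]), hA₂.real b (by simp [Prog.realWrites]),
        hA₁.real b (by simp [Prog.realWrites])]
    refine Runs.mono (Runs.seq (distProg_spec (s := s') (M := M) (n := n) (m := m) (i := i) (j := j)
      (a := a) (h := h) hh (by rw [e 2 (by simp), h2]) (by rw [e 0 (by simp), h0])
      (by rw [e 3 (by simp), h3]) hv (by rw [e 12 (by simp), h12]) (by rw [e 13 (by simp), h13])
      (by rw [er, h4])) fun s₃ hA₃ hc₃ => Runs.seq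
      (Q := fun s₄ => s₄.nat 6 a = encode B (i + 1) c ∧ ∀ x, x ≠ a → s₄.nat 6 x = s.nat 6 x)
      (Runs.setNat (T := 20) ?_ (by simp [NExp.cost])) fun s₄ hA₄ hq₄ =>
      Runs.setNat (T := 20) ?_ (by simp [NExp.cost])) le_rfl fun _ _ hq => hq
    · have e6 : s₃.nat 6 = s'.nat 6 := hA₃.nat 6 (by decide)
      have e8 : s₃.nat 8 = s'.nat 8 := hA₃.nat 8 (by decide)
      have e13 : s₃.nat 13 = s.nat 13 := by rw [hA₃.nat 13 (by decide), e 13 (by simp)]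
      rw [er 2] at hc₃
      simp +contextual [NExp.eval, e13, h13, e6, e8, hI.1, hI.2.1, hI.2.2, hc₃, encode_succ, hc]
    · have e8 : s₄.nat 8 = s'.nat 8 := by rw [hA₄.nat 8 (by decide), hA₃.nat 8 (by decide)]
      have e14 : s₄.nat 14 = s.nat 14 := by
        rw [hA₄.nat 14 (by decide), hA₃.nat 14 (by decide), e 14 (by simp)]
      simp +contextual [NExp.eval, e14, h14, e8, hI.2.1, hq₄.1, hq₄.2, pow_succ]
  · simp [NExp.cost]
    nlinarith
  · exact fun s' _ hI => ⟨hI.1, hI.2.2⟩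

/-- Computes the encoded distance vectors for coordinate `j`. -/
def keysProg : Prog := .for 13 (.add (.mul (.const 2) (.var 2)) (.const 1)) keyProg

theorem keysProg_spec {s : Memory} {M n k m j B : ℕ} {h : ℝ} (hh : 0 < h) (hk : 1 ≤ k)
    (h2 : s.nat 2 0 = M) (h0 : s.nat 0 0 = n) (h01 : s.nat 0 1 = k) (h3 : s.nat 3 0 = m)
    (h12 : s.nat 12 0 = j) (h14 : s.nat 14 0 = B) (h4 : s.real 4 0 = h) :
    Runs keysProg s (3000 * k * (2 * M + 1) ^ 2) fun s' =>
      ∀ a < 2 * M + 1, s'.nat 6 a = encode B k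
        fun i => roundedDist M h (fun i j => s.real 2 (i * n + j)) m i j a := by
  refine Runs.mono (Runs.for (N := 2 * M + 1) (T := 1000 * k * (2 * M + 1))
    (fun b s' => ∀ a < b, s'.nat 6 a = encode B k
        fun i => roundedDist M h (fun i j => s.real 2 (i * n + j)) m i j a)
    (by decide) ?_ ?_ ?_) (T' := 3000 * k * (2 * M + 1) ^ 2) ?_ fun _ _ hq => hq
  · intro s' hA
    simp [NExp.eval, hA.nat 2 (by decide), h2]
  · simp
  · intro a ha s' hA hv hI
    have e : ∀ b, b = 0 ∨ b = 2 ∨ b = 3 ∨ b = 12 ∨ b = 14 → s'.nat b = s.nat b := by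
      rintro b (rfl | rfl | rfl | rfl | rfl) <;> rw [hA.nat _ (by decide)]
    have er : ∀ b, s'.real b = s.real b := fun b => by
      rw [hA.real b (by simp [Prog.realWrites, Prog.for, distProg, keyProg])]
    have hspec := keyProg_spec (s := s') (M := M) (n := n) (k := k) (m := m) (j := j)
      (a := a) (B := B) (h := h) hh hk (by rw [e 2 (by simp), h2]) (by rw [e 0 (by simp), h0])
      (by rw [e 0 (by simp), h01])
      (by rw [e 3 (by simp), h3]) (by rw [e 12 (by simp), h12]) hv (by rw [e 14 (by simp), h14])
      (by rw [er, h4])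
    rw [er 2] at hspec
    refine hspec.mono le_rfl ?_
    rintro s'' - ⟨hq1, hq2⟩ x hx
    rw [writeNat_nat_of_ne _ _ _ (by decide)]
    rcases Nat.lt_succ_iff_lt_or_eq.1 hx with hx | rfl
    · rw [hq2 x hx.ne, hI x hx]
    · exact hq1
  · simp [NExp.cost]
    nlinarith [Nat.zero_le M, mul_le_mul hk (le_refl (2 * M + 1)) (Nat.zero_le _) (Nat.zero_le _)]

end RealRAM

/-! ### Filling the table of the dynamic program. -/

namespace RealRAM

/-- Computes layer `j + 1` of the table from layer `j`. -/
def layerProg : Prog :=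
  .for 16 (.var 4) (.seq (.assign 7 (.const 0)) (.seq
    (.for 13 (.add (.mul (.const 2) (.var 2)) (.const 1))
      (.assign 7 (.add (.var 7)
        (.cell 5 (.add (.add (.mul (.var 12) (.var 4)) (.var 16)) (.cell 6 (.var 13)))))))
    (.setNat 5 (.add (.mul (.add (.var 12) (.const 1)) (.var 4)) (.var 16))
      (.mul (.cell 5 (.var 16)) (.var 7)))))

/-- The table `F` holds layer `j` of the dynamic program. -/
def HasLayer (k L B : ℕ) (ok : ℕ → ℕ → Prop) (c : ℕ → ℕ → ℕ → ℕ) (j : ℕ) (F : ℕ → ℕ) : Prop :=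
  ∀ w : ℕ → ℕ, (∀ i < k, w i < B) → F (j * B ^ k + encode B k w) = dpCount k L ok c j w

theorem layerProg_spec {s : Memory} {M k j B : ℕ} {ok : ℕ → ℕ → Prop} {c : ℕ → ℕ → ℕ → ℕ}
    (hB0 : 1 ≤ B) (hok : ∀ i d e, ok i (d + e) → ok i d) (hB : ∀ i d a, ok i d → d + c i j a < B)
    (h2 : s.nat 2 0 = M) (h4 : s.nat 4 0 = B ^ k) (h12 : s.nat 12 0 = j)
    (h6 : ∀ a < 2 * M + 1, s.nat 6 a = encode B k fun i => c i j a)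
    (hF0 : HasLayer k (2 * M + 1) B ok c 0 (s.nat 5))
    (hFj : HasLayer k (2 * M + 1) B ok c j (s.nat 5)) :
    Runs layerProg s (1000 * B ^ k * (2 * M + 1)) fun s' =>
      HasLayer k (2 * M + 1) B ok c 0 (s'.nat 5) ∧
      HasLayer k (2 * M + 1) B ok c (j + 1) (s'.nat 5) := by
  have hQ : 1 ≤ B ^ k := Nat.one_le_pow _ _ hB0
  refine Runs.mono (Runs.for (N := B ^ k) (T := 10 + ((2 * M + 1 + 1) * (30 + 6 + 11) + 30))
    (fun U s' => (∀ x < (j + 1) * B ^ k, s'.nat 5 x = s.nat 5 x) ∧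
      ∀ w : ℕ → ℕ, (∀ i < k, w i < B) → encode B k w < U →
        s'.nat 5 ((j + 1) * B ^ k + encode B k w) = dpCount k (2 * M + 1) ok c (j + 1) w)
    (by decide) ?_ ?_ ?_) (T' := 1000 * B ^ k * (2 * M + 1)) ?_ ?_
  · intro s' hA
    simp [NExp.eval, hA.nat 4 (by decide), h4]
  · simp
  · intro U hU s' hA hv hI
    have e : ∀ b, b = 2 ∨ b = 4 ∨ b = 6 ∨ b = 12 → s'.nat b = s.nat b := by
      rintro b (rfl | rfl | rfl | rfl) <;> rw [hA.nat _ (by decide)]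
    refine Runs.seq (Q := fun s' => s'.nat 7 0 = 0) (T := 10)
      (Runs.setNat (by simp [NExp.eval]) (by simp [NExp.cost])) fun s₁ hA₁ hz₁ => ?_
    have e1 : ∀ b, b = 2 ∨ b = 4 ∨ b = 6 ∨ b = 12 → s₁.nat b = s.nat b := by
      rintro b (rfl | rfl | rfl | rfl) <;> rw [hA₁.nat _ (by decide), e _ (by simp)]
    have e5 : s₁.nat 5 = s'.nat 5 := hA₁.nat 5 (by decide)
    have e16 : s₁.nat 16 0 = U := by rw [hA₁.nat 16 (by decide), hv]
    refine Runs.mono (Runs.seq (T' := 30) (Runs.for (N := 2 * M + 1) (T := 30)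
      (fun b s₂ => s₂.nat 7 0 = ∑ a ∈ Finset.range b,
        s'.nat 5 (j * B ^ k + U + encode B k fun i => c i j a)) (by decide) ?_ ?_ ?_)
      fun s₃ hA₃ hq₃ => Runs.setNat ?_ (by simp [NExp.cost])) (by simp [NExp.cost])
      fun _ _ hq => hq
    · intro s₂ hA₂
      simp [NExp.eval, hA₂.nat 2 (by decide), e1 2 (by simp), h2]
    · simp [hz₁]
    · intro a ha s₂ hA₂ hv₂ hI₂
      refine Runs.setNat ?_ (by simp [NExp.cost])
      simp [NExp.eval, hI₂, hv₂, hA₂.nat 12 (by decide), hA₂.nat 4 (by decide),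
        hA₂.nat 16 (by decide), hA₂.nat 6 (by decide), hA₂.nat 5 (by decide), e5, e16,
        e1 12 (by simp), e1 4 (by simp), e1 6 (by simp), h12, h4, h6 a ha,
        Finset.sum_range_succ]
    · have e3 : ∀ b, b = 4 ∨ b = 12 → s₃.nat b = s.nat b := by
        rintro b (rfl | rfl) <;> rw [hA₃.nat _ (by decide), e1 _ (by simp)]
      have e5' : s₃.nat 5 = s'.nat 5 := by rw [hA₃.nat 5 (by decide), e5]
      have e16' : s₃.nat 16 0 = U := by rw [hA₃.nat 16 (by decide), e16]
      simp only [NExp.eval, e3 4 (by simp), e3 12 (by simp), h4, h12, e16', e5', hq₃,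
        writeNat_nat, true_and, show (5 : ℕ) ≠ 16 by decide, false_and, if_false]
      constructor
      · intro x hx
        rw [if_neg (by omega), hI.1 x hx]
      · intro w hw hwU
        rcases Nat.lt_succ_iff_lt_or_eq.1 hwU with hlt | heq
        · rw [if_neg (by omega), hI.2 w hw hlt]
        · rw [if_pos (by omega), ← heq]
          -- The entries that matter in layers `0` and `j` lie below layer `j + 1`, the only part
          -- being overwritten.
          have hle : ∀ x < B ^ k, x < (j + 1) * B ^ k ∧ j * B ^ k + x < (j + 1) * B ^ k := by
            intro x hx
            rw [Nat.succ_mul]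
            omega
          have := dpCount_succ_eq (k := k) (L := 2 * M + 1) (B := B) (j := j) (ok := ok) (c := c)
            hok hB (F₀ := s'.nat 5) (F := fun x => s'.nat 5 (j * B ^ k + x))
            (fun w hw => by
              rw [hI.1 _ (hle _ (encode_lt hw)).1, ← hF0 w hw, zero_mul, zero_add])
            (fun w hw => by
              rw [hI.1 _ (hle _ (encode_lt hw)).2, ← hFj w hw]) hw
          simpa only [add_assoc] using this
  · simp only [NExp.cost]
    nlinarith [mul_le_mul hQ (le_refl (2 * M + 1)) (Nat.zero_le _) (Nat.zero_le _)]
  · rintro s' - ⟨hI1, hI2⟩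
    refine ⟨fun w hw => ?_, fun w hw => hI2 w hw (encode_lt hw)⟩
    rw [← hF0 w hw, hI1]
    have := encode_lt hw
    rw [Nat.succ_mul]
    omega

/-- Computes all layers of the table. -/
def tableProg : Prog := .for 12 dimE (.seq keysProg layerProg)

theorem tableProg_spec {s : Memory} {M n k m B : ℕ} {h : ℝ} {ok : ℕ → ℕ → Prop} (hh : 0 < h)
    (hk : 1 ≤ k) (hn : 1 ≤ n) (hBM : B = 4 * M + 2)
    (hok : ∀ i d e, ok i (d + e) → ok i d) (hokM : ∀ i d, ok i d → d ≤ 2 * M)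
    (h2 : s.nat 2 0 = M) (h0 : s.nat 0 0 = n) (h01 : s.nat 0 1 = k) (h3 : s.nat 3 0 = m)
    (h14 : s.nat 14 0 = B) (h4 : s.real 4 0 = h) (hQ : s.nat 4 0 = B ^ k)
    (hF : HasLayer k (2 * M + 1) B ok
      (roundedDist M h (fun i j => s.real 2 (i * n + j)) m) 0 (s.nat 5)) :
    Runs tableProg s (8100 * n * k * B ^ (k + 1)) fun s' =>
      HasLayer k (2 * M + 1) B ok
      (roundedDist M h (fun i j => s.real 2 (i * n + j)) m) n (s'.nat 5) := by
  set c := roundedDist M h (fun i j => s.real 2 (i * n + j)) m with hc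
  refine Runs.mono (Runs.for (N := n)
    (T := 3000 * k * (2 * M + 1) ^ 2 + 1000 * B ^ k * (2 * M + 1))
    (fun j s' => HasLayer k (2 * M + 1) B ok c 0 (s'.nat 5) ∧
      HasLayer k (2 * M + 1) B ok c j (s'.nat 5)) (by decide) ?_ ?_ ?_)
    (T' := 8100 * n * k * B ^ (k + 1)) ?_ fun _ _ hq => hq.2
  · intro s' hA
    simp [NExp.eval, hA.nat 0 (by decide), h0]
  · rw [writeNat_nat_of_ne _ _ _ (by decide)]
    exact ⟨hF, hF⟩
  · intro j hj s' hA hv hI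
    have e : ∀ b, b = 0 ∨ b = 2 ∨ b = 3 ∨ b = 4 ∨ b = 14 → s'.nat b = s.nat b := by
      rintro b (rfl | rfl | rfl | rfl | rfl) <;> rw [hA.nat _ (by decide)]
    have er : ∀ b, s'.real b = s.real b := fun b => by
      rw [hA.real b (by
        simp [Prog.realWrites, Prog.for, distProg, keyProg, keysProg, layerProg])]
    have hkeys := keysProg_spec (s := s') (M := M) (n := n) (k := k) (m := m) (j := j) (B := B)
      (h := h) hh hk (by rw [e 2 (by simp), h2]) (by rw [e 0 (by simp), h0])
      (by rw [e 0 (by simp), h01]) (by rw [e 3 (by simp), h3]) hv (by rw [e 14 (by simp), h14])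
      (by rw [er, h4])
    rw [er 2] at hkeys
    refine Runs.seq hkeys fun s₁ hA₁ hq₁ => ?_
    have e5 : s₁.nat 5 = s'.nat 5 := hA₁.nat 5 (by decide)
    refine (layerProg_spec (s := s₁) (M := M) (k := k) (j := j) (B := B) (ok := ok) (c := c)
      (by omega) hok (fun i d a hd => ?_) (by rw [hA₁.nat 2 (by decide), e 2 (by simp), h2])
      (by rw [hA₁.nat 4 (by decide), e 4 (by simp), hQ])
      (by rw [hA₁.nat 12 (by decide), hv]) hq₁ (by rw [e5]; exact hI.1)
      (by rw [e5]; exact hI.2)).mono le_rfl fun s₂ _ hq₂ => ?_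
    -- An admissible digit and an increment are each at most `2 * M`, so their sum stays below `B =
    -- 4 * M + 2`.
    · have h1 := hokM i d hd
      have h2 : c i j a ≤ 2 * M := Nat.min_le_left _ _
      omega
    · rw [writeNat_nat_of_ne _ _ _ (by decide)]
      exact hq₂
  · have hL : 2 * M + 1 ≤ B := by omega
    have h1 : (2 * M + 1) ^ 2 ≤ B ^ (k + 1) :=
      (Nat.pow_le_pow_left hL 2).trans (Nat.pow_le_pow_right (by omega) (by omega))
    have h2 : B ^ k * (2 * M + 1) ≤ B ^ (k + 1) := Nat.mul_le_mul_left _ hL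
    have h3 : 1 ≤ B ^ (k + 1) := Nat.one_le_pow _ _ (by omega)
    have h4 : 3000 * k * (2 * M + 1) ^ 2 + 1000 * B ^ k * (2 * M + 1) + NExp.cost dimE + 11 ≤
        4050 * (k * B ^ (k + 1)) := by
      simp only [NExp.cost]
      nlinarith [Nat.mul_le_mul_left k h1, Nat.mul_le_mul_right (B ^ (k + 1)) hk]
    calc _ ≤ (2 * n) * (4050 * (k * B ^ (k + 1))) := Nat.mul_le_mul (by omega) h4
      _ = _ := by ring

/-- Fills layer `0` of the table. -/
def validProg : Prog :=
  .seq (.setNat 5 (.const 0) (.const 1)) (.seq (.assign 4 (.const 1))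
    (.for 9 numE (.seq
      (.for 10 (.var 14) (.for 11 (.var 4)
        (.ite (.and (.natLe (.var 10) (.mul (.const 2) (.var 2)))
            (.realLe (.mul (.ofNat (.var 10)) widthE) (.cell 1 (.var 9))))
          (.setNat 5 (.add (.mul (.var 10) (.var 4)) (.var 11)) (.cell 5 (.var 11)))
          (.setNat 5 (.add (.mul (.var 10) (.var 4)) (.var 11)) (.const 0)))))
      (.assign 4 (.mul (.var 4) (.var 14))))))

theorem validProg_spec {s : Memory} {M k B : ℕ} {h : ℝ} {r : ℕ → ℝ} (hk : 1 ≤ k) (hB : 1 ≤ B)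
    (hr : ∀ i < k, 0 ≤ r i)
    (h2 : s.nat 2 0 = M) (h01 : s.nat 0 1 = k) (h14 : s.nat 14 0 = B) (h4 : s.real 4 0 = h)
    (h1 : s.real 1 = r) :
    Runs validProg s (1000 * k * B ^ k) fun s' =>
      s'.nat 4 0 = B ^ k ∧
      ∀ x < B ^ k, s'.nat 5 x = validCode B (fun i d => d ≤ 2 * M ∧ (d : ℝ) * h ≤ r i) k x := by
  set ok : ℕ → ℕ → Prop := fun i d => d ≤ 2 * M ∧ (d : ℝ) * h ≤ r i with hok
  refine Runs.mono (Runs.seq (Q := fun s' => s'.nat 5 0 = 1) (Runs.setNat (by simp [NExp.eval])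
    le_rfl) fun s₁ hA₁ hz₁ => Runs.seq (Q := fun s' => s'.nat 4 0 = 1 ∧ s'.nat 5 0 = 1)
    (Runs.setNat (by simp [NExp.eval, hz₁]) le_rfl) fun s₂ hA₂ hz₂ =>
    Runs.for (N := k) (T := 400 * B ^ k + 20)
    (fun i s' => s'.nat 4 0 = B ^ i ∧ ∀ x < B ^ i, s'.nat 5 x = validCode B ok i x)
    (by decide) ?_ ?_ ?_)
    (T' := 1000 * k * B ^ k) ?_ fun _ _ hq => hq
  · intro s' hA
    simp [NExp.eval, hA.nat 0 (by decide), hA₂.nat 0 (by decide), hA₁.nat 0 (by decide), h01]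
  · simp [hz₂, validCode]
  · intro i hi s' hA hv hI
    have e : ∀ b, b = 0 ∨ b = 2 ∨ b = 14 → s'.nat b = s.nat b := by
      rintro b (rfl | rfl | rfl) <;>
      rw [hA.nat _ (by decide), hA₂.nat _ (by decide), hA₁.nat _ (by decide)]
    have er : ∀ b, s'.real b = s.real b := fun b => by
      rw [hA.real b (by simp [Prog.realWrites, Prog.for]), hA₂.real b (by simp [Prog.realWrites]),
        hA₁.real b (by simp [Prog.realWrites])]
    -- Block `d` of the extended table is computed from block `0` in place. The pass `d = 0`
    -- rewrites block `0` itself, which is harmless because the digit `0` is admissible.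
    have hi0 : ok i 0 := ⟨Nat.zero_le _, by simpa using hr i hi⟩
    have hQ : 1 ≤ B ^ i := Nat.one_le_pow _ _ hB
    have hQk : B ^ i * B ≤ B ^ k := by
      rw [← pow_succ]; exact Nat.pow_le_pow_right hB hi
    refine Runs.seq (T := 400 * B ^ k)
      (Q := fun s' => ∀ x < B ^ (i + 1), s'.nat 5 x = validCode B ok (i + 1) x) ?_
      fun s₃ hA₃ hq₃ => ?_
    · refine Runs.mono (Runs.for (N := B) (T := (B ^ i + 1) * (50 + 2 + 11))
        (fun d s' => (∀ x < B ^ i, s'.nat 5 x = validCode B ok i x) ∧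
          ∀ x < d * B ^ i, s'.nat 5 x = validCode B ok (i + 1) x) (by decide) ?_ ?_ ?_) ?_ ?_
      · intro s'' hA'
        simp [NExp.eval, hA'.nat 14 (by decide), e 14 (by simp), h14]
      · simpa using hI.2
      · intro d hd s'' hA' hv' hI'
        refine Runs.mono (Runs.for (N := B ^ i) (T := 50)
          (fun V s' => (∀ x < B ^ i, s'.nat 5 x = validCode B ok i x) ∧
            ∀ x < d * B ^ i + V, s'.nat 5 x = validCode B ok (i + 1) x) (by decide) ?_ ?_ ?_)
          le_rfl ?_
        · intro s₃ hA₃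
          simp [NExp.eval, hA₃.nat 4 (by decide), hA'.nat 4 (by decide), hI.1]
        · simpa using hI'
        · intro V hV s₃ hA₃ hv₃ hI₃
          have e3 : ∀ b, b = 0 ∨ b = 2 ∨ b = 4 ∨ b = 9 → s₃.nat b = s'.nat b := by
            rintro b (rfl | rfl | rfl | rfl) <;>
            rw [hA₃.nat _ (by decide), hA'.nat _ (by decide)]
          have er3 : ∀ b, s₃.real b = s.real b := fun b => by
            rw [hA₃.real b (by simp [Prog.realWrites, Prog.for]),
              hA'.real b (by simp [Prog.realWrites, Prog.for]), er b]
          have e10 : s₃.nat 10 0 = d := by rw [hA₃.nat 10 (by decide), hv']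
          have hkey : ∀ v, v = validCode B ok (i + 1) (d * B ^ i + V) →
              (∀ x < B ^ i, ((s₃.writeNat 5 (d * B ^ i + V) v).writeNat 11 0 (V + 1)).nat 5 x =
                validCode B ok i x) ∧
              ∀ x < d * B ^ i + (V + 1),
                ((s₃.writeNat 5 (d * B ^ i + V) v).writeNat 11 0 (V + 1)).nat 5 x =
                validCode B ok (i + 1) x := by
            intro v hv
            simp only [writeNat_nat, show (5 : ℕ) ≠ 11 by decide, false_and, if_false, true_and]
            constructor
            · intro x hx
              split_ifs with hxe
              · rw [hv, ← hxe, validCode_succ_of_lt hx hi0]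
              · exact hI₃.1 x hx
            · intro x hx
              split_ifs with hxe
              · rw [hv, hxe]
              · exact hI₃.2 x (by omega)
          rw [validCode_succ_mul_add ok hV] at hkey
          have htest : (Test.and (.natLe (.var 10) (.mul (.const 2) (.var 2)))
            (.realLe (.mul (.ofNat (.var 10)) widthE) (.cell 1 (.var 9)))).holds s₃ ↔ ok i d := by
            simp [Test.holds, NExp.eval, RExp.eval, e10, er3, e3, e, h2, h4, h1, hv, hok]
          refine Runs.mono (Runs.ite (T := 20) (fun ht => Runs.setNat ?_ (by simp [NExp.cost]))
            fun ht => Runs.setNat ?_ (by simp [NExp.cost])) ?_ fun _ _ hq => hq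
          · rw [htest] at ht
            rw [if_pos ht] at hkey
            simp only [NExp.eval, e10, e3 4 (by simp), hI.1, hv₃]
            exact hkey _ (hI₃.1 V hV)
          · rw [htest] at ht
            rw [if_neg ht] at hkey
            simp only [NExp.eval, e10, e3 4 (by simp), hI.1, hv₃]
            exact hkey _ rfl
          · simp [Test.cost, NExp.cost, RExp.cost]
        · intro s₃ _ hq
          rw [writeNat_nat_of_ne _ _ _ (by decide), Nat.succ_mul]
          exact hq
      · simp only [NExp.cost]
        nlinarith
      · intro s'' _ hq
        rw [pow_succ, mul_comm]
        exact hq.2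
    · refine Runs.setNat ?_ (by simp [NExp.cost])
      have e4 : s₃.nat 4 = s'.nat 4 := hA₃.nat 4 (by decide)
      constructor
      · simp [NExp.eval, e4, hA₃.nat 14 (by decide), e 14 (by simp), h14, hI.1, pow_succ]
      · simpa using hq₃
  · have hQ : 1 ≤ B ^ k := Nat.one_le_pow _ _ hB
    simp only [NExp.cost]
    nlinarith [Nat.mul_le_mul_right (B ^ k) hk]

end RealRAM

/-! ### Precision, smallest radius, final scaling, and the whole program. -/

namespace RealRAM

/-- Computes a natural number `D` with `1 ≤ D * δ`. -/
def precProg : Prog :=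
  .seq (.assign 1 (.const 1))
    (.loop (.not (.realLe (.ofNat (.const 1)) (.mul (.ofNat (.var 1)) (.cell 0 (.const 0)))))
      (.assign 1 (.add (.var 1) (.const 1))))

/-- The number `N` enters only the time bound: the loop stops at the first `D` with `1 ≤ D * δ`, no
later than at `N`. -/
theorem precProg_spec {s : Memory} {δ : ℝ} {N : ℕ} (hδ1 : δ ≤ 1)
    (h0 : s.real 0 0 = δ) (hN : 1 ≤ N * δ) :
    Runs precProg s (20 * N + 20) fun s' =>
      1 ≤ s'.nat 1 0 ∧ 1 ≤ (s'.nat 1 0 : ℝ) * δ ∧ (s'.nat 1 0 : ℝ) * δ ≤ 2 := by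
  have key : ∀ d D : ℕ, D + d = N → ∀ s : Memory, s.real 0 0 = δ → s.nat 1 0 = D → 1 ≤ D →
      (D : ℝ) * δ ≤ 2 →
      Runs (.loop (.not (.realLe (.ofNat (.const 1))
        (.mul (.ofNat (.var 1)) (.cell 0 (.const 0))))) (.assign 1 (.add (.var 1) (.const 1))))
        s (20 * d + 11) fun s' =>
        1 ≤ s'.nat 1 0 ∧ 1 ≤ (s'.nat 1 0 : ℝ) * δ ∧ (s'.nat 1 0 : ℝ) * δ ≤ 2 := by
    intro d
    induction d with
    | zero =>
      intro D hD s hs hs1 h1 h2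
      obtain rfl : D = N := by omega
      refine ⟨_, _, .loopDone ?_, ?_, ?_⟩
      · simpa [Test.holds, RExp.eval, NExp.eval, hs, hs1] using hN
      · simp [Test.cost, RExp.cost, NExp.cost]
      · simpa only [hs1] using ⟨h1, hN, h2⟩
    | succ d ih =>
      intro D hD s hs hs1 h1 h2
      by_cases hD1 : 1 ≤ (D : ℝ) * δ
      · refine ⟨_, _, .loopDone ?_, ?_, ?_⟩
        · simpa [Test.holds, RExp.eval, NExp.eval, hs, hs1] using hD1
        · simp only [Test.cost, RExp.cost, NExp.cost]; omega
        · simpa only [hs1] using ⟨h1, hD1, h2⟩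
      · have hset := Exec.setNat 1 (.const 0) (.add (.var 1) (.const 1)) s
        simp only [NExp.eval, NExp.cost, hs1] at hset
        -- The test failed, so `D * δ < 1`; with `δ ≤ 1` the next value keeps `(D + 1) * δ ≤ 2`.
        obtain ⟨t, s', he, ht, hq⟩ := ih (D + 1) (by omega) (s.writeNat 1 0 (D + 1)) (by simpa)
          (by simp) (by omega) (by push_cast; linarith)
        refine ⟨_, _, .loopStep ?_ hset he, ?_, hq⟩
        · simpa [Test.holds, RExp.eval, NExp.eval, hs, hs1] using hD1
        · simp only [Test.cost, RExp.cost, NExp.cost]; omega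
  have hN1 : 1 ≤ N := by
    rcases Nat.eq_zero_or_pos N with rfl | h
    · norm_num at hN
    · exact h
  refine Runs.mono (Runs.seq (T' := 20 * (N - 1) + 11)
    (Q := fun s' => s'.nat 1 0 = 1) (Runs.setNat (by simp [NExp.eval]) le_rfl)
    fun s₁ hA₁ hz₁ => key (N - 1) 1 (by omega) s₁ ?_ hz₁ le_rfl ?_) ?_ fun _ _ hq => hq
  · rw [hA₁.real 0 (by decide), h0]
  · push_cast; linarith
  · simp only [NExp.cost]; omega

/-- Finds a smallest radius. -/
def minProg : Prog :=
  .seq (.assign 3 (.const 0))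
    (.for 9 numE (.ite (.realLe (.cell 1 (.var 9)) (.cell 1 (.var 3))) (.assign 3 (.var 9)) .skip))

theorem minProg_spec {s : Memory} {k : ℕ} {r : ℕ → ℝ} (hk : 1 ≤ k)
    (h01 : s.nat 0 1 = k) (h1 : s.real 1 = r) :
    Runs minProg s (100 * k) fun s' => s'.nat 3 0 < k ∧ ∀ i < k, r (s'.nat 3 0) ≤ r i := by
  refine Runs.mono (Runs.seq (Q := fun s' => s'.nat 3 0 = 0) (Runs.setNat (by simp [NExp.eval])
    le_rfl) fun s₁ hA₁ hz₁ => Runs.for (N := k) (T := 20)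
    (fun i s' => s'.nat 3 0 < k ∧ ∀ i' < i, r (s'.nat 3 0) ≤ r i') (by decide) ?_ ?_ ?_)
    (T' := 100 * k) ?_ fun _ _ hq => hq
  · intro s' hA
    simp [NExp.eval, hA.nat 0 (by decide), hA₁.nat 0 (by decide), h01]
  · simp [hz₁]; omega
  · intro i hi s' hA hv hI
    have er : s'.real 1 = r := by rw [hA.real 1 (by decide), hA₁.real 1 (by decide), h1]
    refine Runs.mono (Runs.ite (T := 10) (fun ht => Runs.setNat ?_ (by simp [NExp.cost]))
      fun ht => Runs.skip ?_ (by norm_num)) (by simp [Test.cost, RExp.cost, NExp.cost])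
      fun _ _ hq => hq
    · simp only [Test.holds, RExp.eval, NExp.eval, er, hv] at ht
      simp only [NExp.eval, hv, writeNat_nat, show (3 : ℕ) ≠ 9 by decide, false_and, if_false,
        and_self, if_true]
      refine ⟨hi, fun i' hi' => ?_⟩
      rcases Nat.lt_succ_iff_lt_or_eq.1 hi' with h | rfl
      · exact ht.trans (hI.2 i' h)
      · exact le_rfl
    · simp only [Test.holds, RExp.eval, NExp.eval, er, hv, not_le] at ht
      simp only [writeNat_nat, show (3 : ℕ) ≠ 9 by decide, false_and, if_false]
      refine ⟨hI.1, fun i' hi' => ?_⟩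
      rcases Nat.lt_succ_iff_lt_or_eq.1 hi' with h | rfl
      · exact hI.2 i' h
      · exact ht.le
  · simp only [NExp.cost]; omega

/-- Multiplies the number of grid cells with the volume of a cell. -/
def scaleProg : Prog :=
  .seq (.assignReal 3 (.ofNat (.cell 5 (.mul dimE (.var 4)))))
    (.for 9 dimE (.assignReal 3 (.mul (.cell 3 (.const 0)) widthE)))

theorem scaleProg_spec {s : Memory} {n Q : ℕ} {h : ℝ} (hn : 1 ≤ n)
    (h0 : s.nat 0 0 = n) (hQ : s.nat 4 0 = Q) (h4 : s.real 4 0 = h) :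
    Runs scaleProg s (100 * n) fun s' => s'.output = s.nat 5 (n * Q) * h ^ n := by
  refine Runs.mono (Runs.seq (Q := fun s' => s'.real 3 0 = s.nat 5 (n * Q))
    (Runs.setReal (by simp [NExp.eval, RExp.eval, h0, hQ]) le_rfl) fun s₁ hA₁ hz₁ =>
    Runs.for (N := n) (T := 20)
    (fun i s' => s'.real 3 0 = s.nat 5 (n * Q) * h ^ i) (by decide) ?_ ?_ ?_)
    (T' := 100 * n) ?_ fun _ _ hq => hq
  · intro s' hA
    simp [NExp.eval, hA.nat 0 (by decide), hA₁.nat 0 (by decide), h0]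
  · simp [hz₁]
  · intro i hi s' hA hv hI
    refine Runs.setReal ?_ (by simp [NExp.cost, RExp.cost])
    have er : s'.real 4 0 = h := by rw [hA.real 4 (by decide), hA₁.real 4 (by decide), h4]
    simp [NExp.eval, RExp.eval, hI, er, pow_succ, mul_assoc]
  · simp only [NExp.cost, RExp.cost]; omega

/-- The approximation algorithm. -/
def volumeProg : Prog :=
  .seq precProg
  (.seq (.assign 2 (.mul (.mul (.mul (.mul (.const 6) numE) dimE) dimE) (.var 1)))
  (.seq (.assign 14 (.add (.mul (.const 4) (.var 2)) (.const 2)))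
  (.seq minProg
  (.seq (.assignReal 4 (.div (.cell 1 (.var 3)) (.ofNat (.var 2))))
  (.seq validProg (.seq tableProg scaleProg))))))

theorem volumeProg_spec {s : Memory} {n k N : ℕ} {δ : ℝ} {r : ℕ → ℝ} (hn : 1 ≤ n) (hk : 1 ≤ k)
    (hδ1 : δ ≤ 1) (hN : 1 ≤ N * δ) (hr : ∀ i < k, 0 < r i)
    (h00 : s.nat 0 0 = n) (h01 : s.nat 0 1 = k) (hδ : s.real 0 0 = δ) (h1 : s.real 1 = r) :
    ∃ D m M : ℕ, ∃ h : ℝ, 1 ≤ D ∧ 1 ≤ D * δ ∧ D * δ ≤ 2 ∧ m < k ∧ (∀ i < k, r m ≤ r i) ∧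
      M = 6 * k * n * n * D ∧ h = r m / M ∧
      Runs volumeProg s
        (20 * N + 20 + 1000 * k * (4 * M + 2) ^ k + 8100 * n * k * (4 * M + 2) ^ (k + 1) +
          100 * k + 100 * n + 50)
        fun s' => s'.output = dpCount k (2 * M + 1) (fun i d => d ≤ 2 * M ∧ (d : ℝ) * h ≤ r i)
          (roundedDist M h (fun i j => s.real 2 (i * n + j)) m) n (fun _ => 0) * h ^ n := by
  obtain ⟨t₁, s₁, he₁, ht₁, hD, hD1, hD2⟩ := precProg_spec hδ1 hδ hN
  set D := s₁.nat 1 0 with hDdef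
  have hA₁ := he₁.agree
  obtain ⟨M, hM⟩ : ∃ M, M = 6 * k * n * n * D := ⟨_, rfl⟩
  have hM0 : 1 ≤ M := by
    rw [hM]; exact Nat.succ_le_of_lt (by positivity)
  obtain ⟨t₂, s₂, he₂, ht₂, h2₂⟩ : Runs (.assign 2
      (.mul (.mul (.mul (.mul (.const 6) numE) dimE) dimE) (.var 1))) s₁ 20
      (fun s' => s'.nat 2 0 = M) :=
    Runs.setNat (by simp [NExp.eval, hA₁.nat 0 (by decide), h00, h01, hM, ← hDdef])
      (by simp [NExp.cost])
  have hA₂ := he₂.agree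
  obtain ⟨t₃, s₃, he₃, ht₃, h14₃⟩ : Runs (.assign 14 (.add (.mul (.const 4) (.var 2)) (.const 2)))
      s₂ 10 (fun s' => s'.nat 14 0 = 4 * M + 2) :=
    Runs.setNat (by simp [NExp.eval, h2₂]) (by simp [NExp.cost])
  have hA₃ := he₃.agree
  obtain ⟨t₄, s₄, he₄, ht₄, hmk, hmr⟩ := minProg_spec (s := s₃) (k := k) (r := r) hk
    (by rw [hA₃.nat 0 (by decide), hA₂.nat 0 (by decide), hA₁.nat 0 (by decide), h01])
    (by rw [hA₃.real 1 (by decide), hA₂.real 1 (by decide), hA₁.real 1 (by decide), h1])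
  have hA₄ := he₄.agree
  set m := s₄.nat 3 0 with hmdef
  have hr₄ : ∀ b, s₄.real b = s.real b := fun b => by
    rw [hA₄.real b (by simp [Prog.realWrites, minProg, Prog.for]),
      hA₃.real b (by simp [Prog.realWrites]), hA₂.real b (by simp [Prog.realWrites]),
      hA₁.real b (by simp [Prog.realWrites, precProg])]
  have h2₄ : s₄.nat 2 0 = M := by rw [hA₄.nat 2 (by decide), hA₃.nat 2 (by decide), h2₂]
  have h0₄ : s₄.nat 0 = s.nat 0 := by
    rw [hA₄.nat 0 (by decide), hA₃.nat 0 (by decide), hA₂.nat 0 (by decide),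
      hA₁.nat 0 (by decide)]
  have h14₄ : s₄.nat 14 0 = 4 * M + 2 := by rw [hA₄.nat 14 (by decide), h14₃]
  obtain ⟨h, hh⟩ : ∃ h, h = r m / M := ⟨_, rfl⟩
  have hh0 : 0 < h := by
    rw [hh]
    exact div_pos (hr m hmk) (by exact_mod_cast hM0)
  obtain ⟨t₅, s₅, he₅, ht₅, h4₅⟩ : Runs (.assignReal 4 (.div (.cell 1 (.var 3)) (.ofNat (.var 2))))
      s₄ 20 (fun s' => s'.real 4 0 = h) :=
    Runs.setReal (by simp [NExp.eval, RExp.eval, hr₄, h1, h2₄, ← hmdef, hh])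
      (by simp [NExp.cost, RExp.cost])
  have hA₅ := he₅.agree
  have hn₅ : s₅.nat = s₄.nat := by
    funext b
    exact hA₅.nat b (by simp [Prog.natWrites])
  have hB : 1 ≤ 4 * M + 2 := by omega
  obtain ⟨t₆, s₆, he₆, ht₆, hQ₆, hF₆⟩ := validProg_spec (s := s₅) (M := M) (k := k)
    (B := 4 * M + 2) (h := h) (r := r) hk hB (fun i hi => (hr i hi).le) (by rw [hn₅, h2₄])
    (by rw [hn₅, h0₄, h01]) (by rw [hn₅, h14₄]) h4₅
    (by rw [hA₅.real 1 (by decide), hr₄, h1])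
  have hA₆ := he₆.agree
  set ok : ℕ → ℕ → Prop := fun i d => d ≤ 2 * M ∧ (d : ℝ) * h ≤ r i with hok
  have hr₆ : ∀ b, b ≠ 4 → s₆.real b = s.real b := fun b hb => by
    rw [hA₆.real b (by simp [Prog.realWrites, validProg, Prog.for]),
      hA₅.real b (by simpa [Prog.realWrites] using hb), hr₄]
  have h4₆ : s₆.real 4 0 = h := by rw [hA₆.real 4 (by decide), h4₅]
  have htab := tableProg_spec (s := s₆) (M := M) (n := n) (k := k) (m := m) (B := 4 * M + 2)
    (h := h) (ok := ok) hh0 hk hn rfl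
    (fun i d e hde => ⟨le_trans (Nat.le_add_right _ _) hde.1, le_trans (by
      push_cast
      have : 0 ≤ (e : ℝ) * h := by positivity
      linarith) hde.2⟩) (fun i d hd => hd.1)
    (by rw [hA₆.nat 2 (by decide), hn₅, h2₄]) (by rw [hA₆.nat 0 (by decide), hn₅, h0₄, h00])
    (by rw [hA₆.nat 0 (by decide), hn₅, h0₄, h01]) (by rw [hA₆.nat 3 (by decide), hn₅])
    (by rw [hA₆.nat 14 (by decide), hn₅, h14₄]) h4₆ hQ₆
    (fun w hw => by
      rw [zero_mul, zero_add, hF₆ _ (encode_lt hw), validCode_encode ok _ hw])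
  rw [hr₆ 2 (by decide)] at htab
  obtain ⟨t₇, s₇, he₇, ht₇, hF₇⟩ := htab
  have hA₇ := he₇.agree
  obtain ⟨t₈, s₈, he₈, ht₈, hout⟩ := scaleProg_spec (s := s₇) (n := n) (Q := (4 * M + 2) ^ k)
    (h := h) hn (by rw [hA₇.nat 0 (by decide), hA₆.nat 0 (by decide), hn₅, h0₄, h00])
    (by rw [hA₇.nat 4 (by decide), hQ₆]) (by rw [hA₇.real 4 (by decide), h4₆])
  refine ⟨D, m, M, h, hD, hD1, hD2, hmk, hmr, hM, hh, _, s₈,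
    he₁.seq (he₂.seq (he₃.seq (he₄.seq (he₅.seq (he₆.seq (he₇.seq he₈)))))), by omega, ?_⟩
  -- The zero vector has code `0`, so the total count is the first entry of layer `n`.
  have h0 := hF₇ (fun _ => 0) (fun _ _ => by omega)
  simp only [encode, zero_mul, Finset.sum_const_zero, add_zero] at h0
  simp only [hout, h0, hok]

end RealRAM

/-! ### From the output of the program to the volume, and the running time. -/

theorem cellDist_le_two_mul {M a : ℕ} {h q y : ℝ} (hh : 0 < h) (hq : |q - y| ≤ M * h)
    (ha : a ≤ 2 * M) : cellDist h q (y - M * h + a * h) ≤ 2 * M := by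
  refine (Nat.sub_le _ _).trans (Nat.floor_le_of_le ?_)
  rw [div_le_iff₀ hh]
  have h1 : (a : ℝ) * h ≤ 2 * M * h :=
    mul_le_mul_of_nonneg_right (by exact_mod_cast ha) hh.le
  have h2 : 0 ≤ (a : ℝ) * h := by positivity
  rw [abs_le] at hq
  push_cast
  rw [abs_le]
  constructor <;> linarith [hq.1, hq.2]

/-- The program truncates distances at `2 * M`. This never takes effect: grid corners and centres
lie within `M * h` of `p m` in each coordinate, so `cellDist` is at most `2 * M`. -/
theorem dpCount_eq_card_goodCells {k n M m : ℕ} {p : Fin k → Fin n → ℝ} {r : Fin k → ℝ}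
    {P : ℕ → ℕ → ℝ} {R : ℕ → ℝ} (hP : ∀ (i : Fin k) (j : Fin n), P i j = p i j)
    (hR : ∀ i : Fin k, R i = r i) (hd : ∀ i l, ∑ j, |p l j - p i j| ≤ r i) (hm : m < k) {h : ℝ}
    (hh : 0 < h) (hMh : M * h = r ⟨m, hm⟩) :
    dpCount k (2 * M + 1) (fun i d => d ≤ 2 * M ∧ (d : ℝ) * h ≤ R i)
      (RealRAM.roundedDist M h P m) n (fun _ => 0) =
    (goodCells M h r fun i j a => cellDist h (p i j) (p ⟨m, hm⟩ j - M * h + a * h)).card := by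
  rw [dpCount_eq_card, goodCells]
  refine congrArg _ (Finset.ext fun a => ?_)
  simp only [Finset.mem_filter, Finset.mem_univ, true_and]
  have hc : ∀ (i : Fin k) (j : Fin n), RealRAM.roundedDist M h P m i j (a j) =
      cellDist h (p i j) (p ⟨m, hm⟩ j - M * h + (a j : ℕ) * h) := by
    intro i j
    have hPm : P m j = p ⟨m, hm⟩ j := hP ⟨m, hm⟩ j
    rw [RealRAM.roundedDist, hP i j, hPm]
    refine min_eq_right (cellDist_le_two_mul hh ?_ (by omega))
    rw [hMh]
    exact (Finset.single_le_sum (f := fun j => |p i j - p ⟨m, hm⟩ j|) (fun _ _ => abs_nonneg _)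
        (Finset.mem_univ j)).trans (hd ⟨m, hm⟩ i)
  constructor
  · intro H i
    have := H i i.2
    simpa only [zero_add, hc, hR] using this
  · intro H i hi
    have := H ⟨i, hi⟩
    have hc' := hc ⟨i, hi⟩
    have hR' := hR ⟨i, hi⟩
    simp only at hc' hR'
    simpa only [zero_add, hc', hR'] using this

theorem time_le {k n N M D : ℕ} {δ : ℝ} (hk : 1 ≤ k) (hn : 1 ≤ n) (hδ0 : 0 < δ)
    (hN : N * δ ≤ 2) (hD1 : 1 ≤ D) (hD : D * δ ≤ 2) (hM : M = 6 * k * n * n * D) :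
    ((20 * N + 20 + 1000 * k * (4 * M + 2) ^ k + 8100 * n * k * (4 * M + 2) ^ (k + 1) +
          100 * k + 100 * n + 50 : ℕ) : ℝ) ≤
      600000 ^ (k + 1) * ((k : ℝ) ^ (k + 2) * (n : ℝ) ^ (2 * k + 3) / δ ^ (k + 1)) := by
  have hk' : (1 : ℝ) ≤ k := by exact_mod_cast hk
  have hn' : (1 : ℝ) ≤ n := by exact_mod_cast hn
  have hD' : (1 : ℝ) ≤ D := by exact_mod_cast hD1
  -- `M = 6 * k * n ^ 2 * D`, `D * δ ≤ 2` and `1 ≤ D` give `(4 * M + 2) * δ ≤ 48 * k * n ^ 2 + 4`,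
  -- so `X` dominates the base.
  set X : ℝ := 60 * k * n ^ 2 / δ with hX
  have hkn : (1 : ℝ) ≤ k * n ^ 2 := one_le_mul_of_one_le_of_one_le hk' (one_le_pow₀ hn')
  have hB : ((4 * M + 2 : ℕ) : ℝ) ≤ X := by
    rw [hX, le_div_iff₀ hδ0, hM]
    push_cast
    nlinarith [mul_le_mul_of_nonneg_left hD (by positivity : (0 : ℝ) ≤ k * n ^ 2)]
  have hNX : (N : ℝ) ≤ X := by
    rw [hX, le_div_iff₀ hδ0]
    linarith
  have hX1 : 1 ≤ X := le_trans (by push_cast; linarith [(Nat.cast_nonneg M : (0 : ℝ) ≤ M)]) hB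
  have hB1 : ((4 * M + 2 : ℕ) : ℝ) ^ (k + 1) ≤ X ^ (k + 1) :=
    pow_le_pow_left₀ (by positivity) hB _
  have hB2 : ((4 * M + 2 : ℕ) : ℝ) ^ k ≤ X ^ (k + 1) :=
    (pow_le_pow_left₀ (by positivity) hB _).trans (pow_le_pow_right₀ hX1 (by omega))
  have hX2 : X ≤ X ^ (k + 1) := le_self_pow₀ hX1 (by omega)
  set Y := X ^ (k + 1) with hY
  have hY1 : 1 ≤ Y := hX1.trans hX2
  have hnk : (1 : ℝ) ≤ n * k := one_le_mul_of_one_le_of_one_le hn' hk'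
  have hYnk : Y ≤ n * k * Y := le_mul_of_one_le_left (by linarith) hnk
  have hkY : k * Y ≤ n * k * Y := by
    rw [mul_assoc]; exact le_mul_of_one_le_left (by positivity) hn'
  have hk1 : (k : ℝ) ≤ k * Y := le_mul_of_one_le_right (by linarith) hY1
  have hn1 : (n : ℝ) ≤ n * k * Y := by
    rw [mul_assoc]
    exact le_mul_of_one_le_right (by linarith) (one_le_mul_of_one_le_of_one_le hk' hY1)
  have h1 := mul_le_mul_of_nonneg_left hB2 (by positivity : (0 : ℝ) ≤ k)
  have h2 := mul_le_mul_of_nonneg_left hB1 (by positivity : (0 : ℝ) ≤ n * k)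
  have hsum : ((20 * N + 20 + 1000 * k * (4 * M + 2) ^ k + 8100 * n * k * (4 * M + 2) ^ (k + 1) +
          100 * k + 100 * n + 50 : ℕ) : ℝ) ≤ 10000 * (n * k * Y) := by
    push_cast at h1 h2 ⊢
    linarith
  refine hsum.trans ?_
  have h3 : (10000 : ℝ) ≤ 10000 ^ (k + 1) := le_self_pow₀ (by norm_num) (by omega)
  have h4 : n * k * Y = 60 ^ (k + 1) *
      ((k : ℝ) ^ (k + 2) * (n : ℝ) ^ (2 * k + 3) / δ ^ (k + 1)) := by
    rw [hY, hX, div_pow, mul_pow, mul_pow, ← pow_mul]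
    ring
  have h5 : (600000 : ℝ) ^ (k + 1) = 10000 ^ (k + 1) * 60 ^ (k + 1) := by
    rw [← mul_pow]; norm_num
  -- The constant splits as `600000 = 10000 * 60`: the first factor covers the numerical constants
  -- of the time bound, the second the `60` in `X`.
  rw [h4, h5, ← mul_assoc, mul_assoc, mul_assoc]
  exact mul_le_mul_of_nonneg_right h3 (by positivity)

theorem input_real_two {k n : ℕ} (p : Fin k → Fin n → ℝ) (r : Fin k → ℝ) (δ : ℝ) (i : Fin k)
    (j : Fin n) : (RealRAM.input p r δ).real 2 (i * n + j) = p i j := by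
  have hlt : (i : ℕ) * n + j < k * n := by
    have := Nat.mul_le_mul_right n (Nat.succ_le_of_lt i.2)
    rw [Nat.succ_mul] at this
    omega
  have h1 : Fin.divNat (⟨i * n + j, hlt⟩ : Fin (k * n)) = i := by
    ext
    simp only [Fin.coe_divNat]
    rw [mul_comm, Nat.mul_add_div (by omega), Nat.div_eq_of_lt j.2, add_zero]
  have h2 : Fin.modNat (⟨i * n + j, hlt⟩ : Fin (k * n)) = j := by
    ext
    simp only [Fin.coe_modNat]
    rw [mul_comm, Nat.mul_add_mod, Nat.mod_eq_of_lt j.2]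
  simp [RealRAM.input, hlt, h1, h2]

theorem mainTheorem4 :
    ∃ (P : RealRAM.Prog) (C : ℝ), 0 < C ∧
      ∀ (k n : ℕ), 1 ≤ k → 1 ≤ n →
      ∀ (p : Fin k → Fin n → ℝ) (r : Fin k → ℝ) (δ : ℝ),
        (∀ i, 0 ≤ r i) →
        (∀ i, p i ∈ interior (crossInter p r)) →
        0 < δ → δ ≤ 1 →
        ∃ (t : ℕ) (s : RealRAM.Memory),
          RealRAM.Exec P (RealRAM.input p r δ) t s ∧
          MeasureTheory.volume.real (crossInter p r) ≤ s.output ∧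
          s.output ≤ (1 + δ) * MeasureTheory.volume.real (crossInter p r) ∧
          (t : ℝ) ≤
            C ^ (k + 1) * ((k : ℝ) ^ (k + 2) * (n : ℝ) ^ (2 * k + 3) / δ ^ (k + 1)) := by
  refine ⟨RealRAM.volumeProg, 600000, by norm_num, ?_⟩
  intro k n hk hn p r δ _ hp hδ0 hδ1
  have hr : ∀ i, 0 < r i := fun i => radius_pos_of_mem_interior hn (hp i)
  have hd : ∀ i l, ∑ j, |p l j - p i j| ≤ r i := fun i l =>
    mem_crossInter.1 (interior_subset (hp l)) i
  obtain ⟨N, hN1, hN2⟩ : ∃ N : ℕ, 1 ≤ N * δ ∧ N * δ ≤ 2 := by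
    refine ⟨⌈1 / δ⌉₊, ?_, ?_⟩
    · rw [← div_le_iff₀ hδ0]
      exact Nat.le_ceil _
    · have h1 : (⌈1 / δ⌉₊ : ℝ) * δ ≤ (1 / δ + 1) * δ :=
        mul_le_mul_of_nonneg_right (Nat.ceil_lt_add_one (by positivity)).le hδ0.le
      have h2 : (1 / δ + 1) * δ = 1 + δ := by field_simp
      linarith
  set s₀ := RealRAM.input p r δ with hs₀
  have hR : ∀ i : Fin k, s₀.real 1 i = r i := fun i => by simp [hs₀, RealRAM.input]
  obtain ⟨D, m, M, h, hD1, hDδ, hDδ2, hmk, hmr, hM, hh, t, s, hexec, ht, hout⟩ :=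
    RealRAM.volumeProg_spec (s := s₀) (n := n) (k := k) (N := N) (δ := δ) (r := s₀.real 1)
      hn hk hδ1 hN1 (fun i hi => by rw [hR ⟨i, hi⟩]; exact hr _) (by simp [hs₀, RealRAM.input])
      (by simp [hs₀, RealRAM.input]) (by simp [hs₀, RealRAM.input]) rfl
  have hM1 : 1 ≤ M := by
    rw [hM]; exact Nat.succ_le_of_lt (by positivity)
  have hM0 : (0 : ℝ) < M := by exact_mod_cast hM1
  have hh' : h = r ⟨m, hmk⟩ / M := by rw [hh, hR ⟨m, hmk⟩]
  have hh0 : 0 < h := by rw [hh']; exact div_pos (hr _) hM0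
  have hcard := dpCount_eq_card_goodCells (p := p) (r := r) (M := M)
    (P := fun i j => s₀.real 2 (i * n + j))
    (R := s₀.real 1) (fun i j => input_real_two p r δ i j) hR hd hmk hh0
    (by rw [hh']; field_simp)
  have hvol := volume_crossInter_approx hk hd ⟨m, hmk⟩
    (fun i => by rw [← hR, ← hR]; exact hmr i i.2) (hr _) hM1 hh'
  simp only at hout hvol
  rw [hcard] at hout
  rw [← hout] at hvol
  refine ⟨t, s, hexec, hvol.1, hvol.2.trans ?_, ?_⟩
  · refine mul_le_mul_of_nonneg_right ?_ MeasureTheory.measureReal_nonneg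
    -- The choice of `M` makes `3 * n * k / M` equal to `1 / (2 * n * D)`.
    refine le_trans (le_of_eq ?_) (one_add_div_pow_le hn hD1 hDδ)
    have hk0 : (0 : ℝ) < k := by exact_mod_cast hk
    have hn0 : (0 : ℝ) < n := by exact_mod_cast hn
    have hD0 : (0 : ℝ) < D := by exact_mod_cast hD1
    rw [hM]
    push_cast
    congr 2
    field_simp
    norm_num
  · exact le_trans (by exact_mod_cast ht) (time_le hk hn hδ0 hN2 hD1 hDδ2 hM)
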